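/- Let $B_3=\langle \sigma_1,\sigma_2\mid \sigma_1\sigma_2\sigma_1=\sigma_2\sigma_1\sigma_2\rangle$ be the 3-braid group, with band generators $a_1=\sigma_1$, $a_2=\sigma_2$, $a_3=\sigma_2\sigma_1\sigma_2^{-1}$. A word in band generators is a finite (possibly empty) sequence of letters $a_i^{\pm1}$, $i\in\{1,2,3\}$, and its length is its number of letters. Let $\alpha\in B_3$ be a 3-braid whose closure $\hat\alpha$ is a nontrivial knot, that is, $\hat\alpha$ has a single component and is not ambient isotopic to the round circle. Then there are a word $W$ in band generators and a sign $\varepsilon\in\{+1,-1\}$ such that the word $Wa_1^{2\varepsilon}$ (the word $W$ followed by two letters $a_1^{\varepsilon}$) represents a braid conjugate to $\alpha$ in $B_3$, and this word is a shortest word in the conjugacy class of $\alpha$: every word in band generators that represents a conjugate of $\alpha$ has length at least that of $Wa_1^{2\varepsilon}$. -/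

import Mathlib

namespace ThreeBraid

/-! ### The 3-braid group and words -/

/-- The relator of the Artin presentation `⟨σ₁, σ₂ ∣ σ₁σ₂σ₁ = σ₂σ₁σ₂⟩`; the generators `σ₁, σ₂` are
indexed by `0, 1 : Fin 2`. -/
def artinRels : Set (FreeGroup (Fin 2)) :=
  {FreeGroup.of 0 * FreeGroup.of 1 * FreeGroup.of 0 *
    (FreeGroup.of 1 * FreeGroup.of 0 * FreeGroup.of 1)⁻¹}

/-- The 3-braid group. -/
abbrev B3 : Type := PresentedGroup artinRels

/-- The Artin generators: `artin 0 = σ₁`, `artin 1 = σ₂`. -/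
def artin (i : Fin 2) : B3 := PresentedGroup.of i

/-- The band generators: `band 0 = a₁ = σ₁`, `band 1 = a₂ = σ₂`, `band 2 = a₃ = σ₂σ₁σ₂⁻¹`. -/
def band : Fin 3 → B3 :=
  ![artin 0, artin 1, artin 1 * artin 0 * (artin 1)⁻¹]

/-- A word in generators indexed by `ι` is a list of letters; the letter `(i, true)` is the
`i`-th generator and `(i, false)` is its inverse. The length of a word is its length as a list. -/
abbrev Word (ι : Type) : Type := List (ι × Bool)

/-- The braid represented by a word, where the generators are interpreted by `g`. -/
def evalWord {ι : Type} (g : ι → B3) (w : Word ι) : B3 :=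
  (w.map fun x => if x.2 then g x.1 else (g x.1)⁻¹).prod

/-- `V` is a shortest word (in band generators) in the conjugacy class of `α`: it represents a
conjugate of `α`, and no word that represents a conjugate of `α` has fewer letters. -/
def IsShortestInConjClass (V : Word (Fin 3)) (α : B3) : Prop :=
  IsConj α (evalWord band V) ∧
    ∀ V' : Word (Fin 3), IsConj α (evalWord band V') → V.length ≤ V'.length

/-! ### Knots in Euclidean 3-space -/

/-- Euclidean 3-space. -/
abbrev E3 : Type := EuclideanSpace ℝ (Fin 3)

/-- A knot: a smoothly embedded circle, that is, the image of a smooth closed curve of period `1`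
that is regular and has no self-intersections. -/
def IsKnot (K : Set E3) : Prop :=
  ∃ f : ℝ → E3, ContDiff ℝ ((⊤ : ℕ∞) : WithTop ℕ∞) f ∧ Function.Periodic f 1 ∧
    (∀ t, deriv f t ≠ 0) ∧ Set.InjOn f (Set.Ico 0 1) ∧ Set.range f = K

/-- Ambient isotopy of subsets of Euclidean 3-space. -/
def AmbientIsotopic (K L : Set E3) : Prop :=
  ∃ H : unitInterval → (E3 ≃ₜ E3),
    Continuous (fun p : unitInterval × E3 => H p.1 p.2) ∧ (∀ x, H 0 x = x) ∧ H 1 '' K = L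

/-- The unit circle in the horizontal coordinate plane. -/
def roundCircle : Set E3 := {x | x 0 ^ 2 + x 1 ^ 2 = 1 ∧ x 2 = 0}

/-- A trivial knot (unknot): a set ambient isotopic to the round circle. -/
def IsUnknot (K : Set E3) : Prop := AmbientIsotopic K roundCircle

/-! ### Closed 3-braids

A geometric 3-braid is drawn as three points moving in the plane `ℂ`, starting and ending in the
configuration `{-1, 0, 1}`. Its closure is obtained by letting time run once around the core of a
standard solid torus in Euclidean space. -/

/-- The points at time `s ∈ [0, 1]` of the motion for a letter: for `σ₁` the points `-1` and `0`
are exchanged by a half turn about `-1/2` and the point `1` rests; for `σ₂` the points `0` and `1`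
are exchanged by a half turn about `1/2` and the point `-1` rests. A generator turns
counterclockwise and its inverse clockwise. The smooth time change `Real.smoothTransition` is flat
at `0` and `1`, so that consecutive motions fit together smoothly. -/
noncomputable def letterConfig (x : Fin 2 × Bool) (s : ℝ) : Set ℂ :=
  let c : ℂ := if x.1 = 0 then -1 / 2 else 1 / 2
  let angle : ℝ := (if x.2 then 1 else -1) * (Real.pi * Real.smoothTransition s)
  {c + 1 / 2 * Complex.exp (angle * Complex.I), c - 1 / 2 * Complex.exp (angle * Complex.I),
    -2 * c}

/-- The points at time `j + s` (`j` a natural number, `s ∈ [0, 1]`) of the motion for a word: in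
the `j`-th unit of time the `j`-th letter is performed; after the last letter the points rest. -/
noncomputable def wordConfig (w : Word (Fin 2)) (j : ℕ) (s : ℝ) : Set ℂ :=
  match w[j]? with
  | some x => letterConfig x s
  | none => {-1, 0, 1}

/-- The point of the standard solid torus around the third coordinate axis, at angle `2πθ`, in the
half-plane section with coordinate `z` centred at distance `2` from the axis. -/
noncomputable def torusPoint (θ : ℝ) (z : ℂ) : E3 :=
  !₂[(2 + z.re) * Real.cos (2 * Real.pi * θ), (2 + z.re) * Real.sin (2 * Real.pi * θ), z.im]

/-- The closed braid of a word of length `n` in the Artin generators: the letters are performed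
one after the other in the first `n` of `n + 1` equal sectors of the solid torus, and in the last
sector the three strands are closed up in parallel. -/
noncomputable def closedBraid (w : Word (Fin 2)) : Set E3 :=
  {p | ∃ j : ℕ, j < w.length + 1 ∧ ∃ s ∈ Set.Icc (0 : ℝ) 1, ∃ z ∈ wordConfig w j s,
    p = torusPoint ((j + s) / (w.length + 1)) z}

/-- `K` is the closure of the 3-braid `α`, drawn from some word in the Artin generators that
represents `α`. -/
def IsClosureOf (K : Set E3) (α : B3) : Prop :=
  ∃ w : Word (Fin 2), evalWord artin w = α ∧ K = closedBraid w

end ThreeBraid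

namespace ThreeBraid

/-! ### Band words -/

/-! Algebra. With indices mod 3, every descending pair `a_{i+1} a_i` equals the same element
`delta`, and conjugation by `delta` permutes the band generators cyclically. These relations push
negative letters to the right without lengthening a word, so a shortest word V may be taken to be
positive followed by negative (`exists_sorted`). Suppose that no shortest word of the class contains
a square, up to cyclic rotation. A descending pair next to another letter could be rewritten to end
with any index, so it would yield a cancellation or a square; hence positive stretches ascend
(`exists_eq_ascending`). For words of length at least 4, the transitions between positive and
negative letters are then so rigid that the underlying permutation is a power of a transposition,
which has a fixed point (`not_fixedPointFree_of_posWord`, `not_fixedPointFree_of_mixed`). A braid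
that closes to a knot has a fixed-point-free permutation (`fixedPointFree_of_isKnot`), so a square
exists, and conjugation by `delta` gives it index 1.

If V has fewer than 4 letters, parity of the 3-cycle leaves exactly two letters of different index,
and the braid is conjugate to a product of one σ₁^{±1} and one σ₂^{±1}. The topological part shows
that such a braid closes to the unknot, which the hypothesis excludes.

Topology. A closed braid is the closure of a loop of unordered configurations, and freely homotopic
loops have ambient isotopic closures (`ambientIsotopic_of_freeHomotopy`): for nearby loops, small
contracting displacements in each section of the solid torus carry one closure to the other.
Together with a homomorphism from the braid group to the fundamental group (`braidHom`), this makes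
the closure a conjugacy invariant up to isotopy. A two-letter loop is deformed to three points
chasing each other along one plane curve. After a quarter turn the closure meets each horizontal
plane in at most two points (`loopClosure_chase`), and affine maps of these planes straighten it to
a circle. -/

theorem artin_braid : artin 0 * artin 1 * artin 0 = artin 1 * artin 0 * artin 1 := by
  have h : FreeGroup.of 0 * FreeGroup.of 1 * FreeGroup.of 0 *
    (FreeGroup.of 1 * FreeGroup.of 0 * FreeGroup.of 1)⁻¹ ∈ artinRels := rfl
  have := PresentedGroup.one_of_mem h
  simp only [map_mul, map_inv] at this
  exact mul_inv_eq_one.1 this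

/-- The dual Garside element `a₂a₁ = a₃a₂ = a₁a₃`. -/
def delta : B3 := artin 1 * artin 0

theorem band_succ_mul (i : Fin 3) : band (i + 1) * band i = delta := by
  have h := artin_braid
  fin_cases i
  · rfl
  · change artin 1 * artin 0 * (artin 1)⁻¹ * artin 1 = _
    simp [delta]
  · change artin 0 * (artin 1 * artin 0 * (artin 1)⁻¹) = _
    rw [← mul_assoc, ← mul_assoc, h, delta, mul_inv_cancel_right]

/-- Bracket `a_{i+2} a_{i+1} a_i` in the two possible ways; either descending pair is `delta`. -/
theorem delta_mul_band (i : Fin 3) : delta * band i = band (i + 2) * delta := by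
  have h : i + 2 = i + 1 + 1 := by omega
  rw [h, ← band_succ_mul i, ← mul_assoc, band_succ_mul (i + 1), band_succ_mul i]

section evalWord

variable {ι : Type} (g : ι → B3)

@[simp] theorem evalWord_nil : evalWord g [] = 1 := rfl

@[simp] theorem evalWord_cons (x : ι × Bool) (w : Word ι) :
    evalWord g (x :: w) = (if x.2 then g x.1 else (g x.1)⁻¹) * evalWord g w := by
  simp [evalWord]

@[simp] theorem evalWord_append (v w : Word ι) :
    evalWord g (v ++ w) = evalWord g v * evalWord g w := by
  simp [evalWord]

/-- The inverse word. -/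
def invWord (w : Word ι) : Word ι := (w.map fun x => (x.1, !x.2)).reverse

theorem evalWord_invWord (w : Word ι) : evalWord g (invWord w) = (evalWord g w)⁻¹ := by
  induction w with
  | nil => simp [invWord]
  | cons x w ih =>
    have : invWord (x :: w) = invWord w ++ [(x.1, !x.2)] := by simp [invWord]
    rw [this, evalWord_append, ih]
    rcases x with ⟨i, _ | _⟩ <;> simp

@[simp] theorem length_invWord (w : Word ι) : (invWord w).length = w.length := by
  simp [invWord]

theorem invWord_append (v w : Word ι) : invWord (v ++ w) = invWord w ++ invWord v := by
  simp [invWord]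

end evalWord

theorem isConj_mul_comm {G : Type*} [Group G] (a b : G) : IsConj (a * b) (b * a) :=
  isConj_iff.2 ⟨b, by group⟩

theorem isConj_inv {G : Type*} [Group G] {a b : G} (h : IsConj a b) : IsConj a⁻¹ b⁻¹ := by
  obtain ⟨c, rfl⟩ := isConj_iff.1 h
  exact isConj_iff.2 ⟨c, by group⟩

/-- The index shift of band words that conjugation by `delta` induces. -/
def shiftWord (w : Word (Fin 3)) : Word (Fin 3) := w.map fun x => (x.1 + 2, x.2)

theorem evalWord_shiftWord (w : Word (Fin 3)) :
    evalWord band (shiftWord w) = delta * evalWord band w * delta⁻¹ := by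
  induction w with
  | nil => simp [shiftWord]
  | cons x w ih =>
    have h : shiftWord (x :: w) = (x.1 + 2, x.2) :: shiftWord w := rfl
    have hb : band (x.1 + 2) = delta * band x.1 * delta⁻¹ :=
      eq_mul_inv_of_mul_eq (delta_mul_band _).symm
    rw [h, evalWord_cons, evalWord_cons, ih]
    rcases x with ⟨i, _ | _⟩ <;> simp only [hb] <;> simp [mul_assoc]

theorem isConj_shiftWord (w : Word (Fin 3)) :
    IsConj (evalWord band w) (evalWord band (shiftWord w)) :=
  isConj_iff.2 ⟨delta, (evalWord_shiftWord w).symm⟩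

namespace IsShortestInConjClass

variable {α : B3} {V V' A B B' C : Word (Fin 3)}

theorem of_isConj (h : IsShortestInConjClass V α)
    (hc : IsConj (evalWord band V) (evalWord band V')) (hl : V'.length ≤ V.length) :
    IsShortestInConjClass V' α :=
  ⟨h.1.trans hc, fun U hU => hl.trans (h.2 U hU)⟩

theorem rotate (h : IsShortestInConjClass (A ++ B) α) : IsShortestInConjClass (B ++ A) α :=
  h.of_isConj (by simpa using isConj_mul_comm _ _) (by simp [add_comm])

theorem replace (h : IsShortestInConjClass (A ++ B ++ C) α)
    (he : evalWord band B = evalWord band B') (hl : B'.length ≤ B.length) :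
    IsShortestInConjClass (A ++ B' ++ C) α :=
  h.of_isConj (by simpa only [evalWord_append, he] using IsConj.refl _) (by simpa using hl)

theorem not_shorter (h : IsShortestInConjClass (A ++ B ++ C) α)
    (he : evalWord band B = evalWord band B') : B.length ≤ B'.length := by
  have := h.2 (A ++ B' ++ C) (by simpa [he] using h.1)
  simpa using this

theorem inv (h : IsShortestInConjClass V α) : IsShortestInConjClass (invWord V) α⁻¹ := by
  refine ⟨by rw [evalWord_invWord]; exact isConj_inv h.1, fun U hU => ?_⟩
  have := h.2 (invWord U) (by rw [evalWord_invWord]; simpa using isConj_inv hU)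
  simpa using this

end IsShortestInConjClass

/-- Some shortest word in the conjugacy class ends with the square of a letter. -/
def HasSquare (α : B3) : Prop :=
  ∃ (W : Word (Fin 3)) (x : Fin 3 × Bool), IsShortestInConjClass (W ++ [x, x]) α

theorem HasSquare.of_shortest {α : B3} {A B : Word (Fin 3)} {x : Fin 3 × Bool}
    (h : IsShortestInConjClass (A ++ [x, x] ++ B) α) : HasSquare α :=
  ⟨B ++ A, x, by simpa using h.rotate⟩

/-- Inversion exchanges positive and negative letters, so later arguments may assume many positive
ones. -/
theorem HasSquare.of_inv {α : B3} (h : HasSquare α⁻¹) : HasSquare α := by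
  obtain ⟨W, x, h⟩ := h
  have h' := h.inv
  rw [inv_inv, invWord_append] at h'
  exact HasSquare.of_shortest (A := []) (x := (x.1, !x.2)) (B := invWord W) (by simpa [invWord] using h')

/-- Conjugating by `delta` shifts all indices by 2 and keeps the length; at most two shifts are
needed. -/
theorem HasSquare.exists_index_zero {α : B3} (h : HasSquare α) :
    ∃ (W : Word (Fin 3)) (e : Bool), IsShortestInConjClass (W ++ [(0, e), (0, e)]) α := by
  obtain ⟨W, ⟨i, e⟩, h⟩ := h
  have h1 := h.of_isConj (isConj_shiftWord _) (by simp [shiftWord])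
  have h2 := h1.of_isConj (isConj_shiftWord _) (by simp [shiftWord])
  fin_cases i
  · exact ⟨W, e, h⟩
  · exact ⟨shiftWord W, e, by simpa [shiftWord] using h1⟩
  · exact ⟨shiftWord (shiftWord W), e, by simpa [shiftWord] using h2⟩

/-! ### Exchange relations for letters -/

/-- Both pairs are `delta`. The point is the freedom to choose the last index `j`. -/
theorem evalWord_descent (i j : Fin 3) :
    evalWord band [(i + 1, true), (i, true)] = evalWord band [(j + 1, true), (j, true)] := by
  simp [band_succ_mul]

/-- Clearing inverses turns this into `a_i a_{i+2} = a_{i+1} a_i`, two expressions for `delta`. -/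
theorem evalWord_neg_pos (i : Fin 3) :
    evalWord band [(i + 1, false), (i, true)] = evalWord band [(i, true), (i + 2, false)] := by
  have h : i = i + 2 + 1 := by omega
  have h1 := band_succ_mul i
  have h2 := band_succ_mul (i + 2)
  rw [← h, ← h1] at h2
  simp only [evalWord_cons, evalWord_nil, mul_one]
  simp only [if_true, Bool.false_eq_true, if_false]
  rw [inv_mul_eq_iff_eq_mul, ← mul_assoc, eq_mul_inv_iff_mul_eq, h2]

theorem evalWord_neg_pos' (i : Fin 3) :
    evalWord band [(i, false), (i + 1, true)] = evalWord band [(i + 2, true), (i, false)] := by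
  have h : i = i + 2 + 1 := by omega
  have h1 := band_succ_mul i
  have h2 := band_succ_mul (i + 2)
  rw [← h, ← h1] at h2
  simp only [evalWord_cons, evalWord_nil, mul_one]
  simp only [if_true, Bool.false_eq_true, if_false]
  rw [inv_mul_eq_iff_eq_mul, ← mul_assoc, eq_mul_inv_iff_mul_eq, h2]

theorem evalWord_cancel (i : Fin 3) (e : Bool) : evalWord band [(i, e), (i, !e)] = evalWord band [] := by
  cases e <;> simp

/-! ### Sorting a word into a positive and a negative part. -/

/-- A positive word. -/
def posWord (P : List (Fin 3)) : Word (Fin 3) := P.map fun i => (i, true)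

/-- A negative word. -/
def negWord (P : List (Fin 3)) : Word (Fin 3) := P.map fun i => (i, false)

theorem exists_neg_pos_swap {j k : Fin 3} (h : j ≠ k) : ∃ k' j' : Fin 3,
    evalWord band [(j, false), (k, true)] = evalWord band [(k', true), (j', false)] := by
  obtain rfl | rfl : j = k + 1 ∨ k = j + 1 := by omega
  · exact ⟨_, _, evalWord_neg_pos k⟩
  · exact ⟨_, _, evalWord_neg_pos' j⟩

/-- The negative letter walks to the right: it cancels against an equal index, and passes any other
one with both indices possibly changed. -/
theorem exists_neg_posWord_swap (j : Fin 3) (P : List (Fin 3)) : ∃ P' N' : List (Fin 3),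
    evalWord band (posWord P' ++ negWord N') = evalWord band ((j, false) :: posWord P) ∧
      P'.length + N'.length ≤ P.length + 1 := by
  induction P generalizing j with
  | nil => exact ⟨[], [j], by simp [posWord, negWord], by simp⟩
  | cons k P ih =>
    by_cases h : j = k
    · subst h
      exact ⟨P, [], by simp [posWord, negWord], by simp; omega⟩
    · obtain ⟨k', j', h⟩ := exists_neg_pos_swap h
      obtain ⟨P', N', h1, h2⟩ := ih j'
      refine ⟨k' :: P', N', ?_, by simp; omega⟩
      have e1 : posWord (k' :: P') ++ negWord N' = (k', true) :: (posWord P' ++ negWord N') := rfl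
      have e2 : (j, false) :: posWord (k :: P) = [(j, false), (k, true)] ++ posWord P := rfl
      rw [e1, e2, evalWord_append, h, evalWord_cons, h1]
      simp [mul_assoc]

theorem exists_sorted (V : Word (Fin 3)) : ∃ P N : List (Fin 3),
    evalWord band (posWord P ++ negWord N) = evalWord band V ∧
      P.length + N.length ≤ V.length := by
  induction V with
  | nil => exact ⟨[], [], by simp [posWord, negWord]⟩
  | cons x V ih =>
    obtain ⟨P, N, h1, h2⟩ := ih
    rcases x with ⟨i, _ | _⟩
    · obtain ⟨P', N', h3, h4⟩ := exists_neg_posWord_swap i P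
      refine ⟨P', N' ++ N, ?_, by simp; omega⟩
      have e1 : posWord P' ++ negWord (N' ++ N) = posWord P' ++ negWord N' ++ negWord N := by
        simp [negWord]
      rw [e1, evalWord_append, h3, evalWord_cons, evalWord_cons, ← h1, evalWord_append, mul_assoc]
    · exact ⟨i :: P, N, by rw [evalWord_cons, ← h1]; rfl, by simp; omega⟩

/-! ### The underlying permutation -/

/-- The transposition of the positions that an Artin generator exchanges. -/
def artinSwap : Fin 2 → Equiv.Perm (Fin 3) := ![Equiv.swap 0 1, Equiv.swap 1 2]

/-- The permutation homomorphism. -/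
def permHom : B3 →* Equiv.Perm (Fin 3) :=
  PresentedGroup.toGroup (f := artinSwap) (by
    rintro r rfl
    simp only [map_mul, map_inv, FreeGroup.lift_apply_of, mul_inv_eq_one]
    decide)

@[simp] theorem permHom_artin (i : Fin 2) : permHom (artin i) = artinSwap i :=
  PresentedGroup.toGroup.of _

/-- The transposition of a band generator. -/
def bandSwap : Fin 3 → Equiv.Perm (Fin 3) := ![Equiv.swap 0 1, Equiv.swap 1 2, Equiv.swap 0 2]

theorem permHom_band (i : Fin 3) : permHom (band i) = bandSwap i := by
  fin_cases i
  · exact permHom_artin 0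
  · exact permHom_artin 1
  · change permHom (artin 1 * artin 0 * (artin 1)⁻¹) = _
    simp only [map_mul, map_inv, permHom_artin]
    decide

/-- A permutation without fixed points. -/
def FixedPointFree (s : Equiv.Perm (Fin 3)) : Prop := ∀ k, s k ≠ k

instance (s : Equiv.Perm (Fin 3)) : Decidable (FixedPointFree s) :=
  inferInstanceAs (Decidable (∀ k, s k ≠ k))

theorem FixedPointFree.of_isConj {a b : B3} (h : IsConj a b) (ha : FixedPointFree (permHom a)) :
    FixedPointFree (permHom b) := by
  obtain ⟨c, rfl⟩ := isConj_iff.1 h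
  intro k hk
  apply ha ((permHom c)⁻¹ k)
  rw [map_mul, map_mul, map_inv, Equiv.Perm.mul_apply, Equiv.Perm.mul_apply] at hk
  exact (permHom c).injective (by simpa using hk)

theorem permHom_letter (x : Fin 3 × Bool) :
    permHom (if x.2 then band x.1 else (band x.1)⁻¹) = bandSwap x.1 := by
  rcases x with ⟨i, _ | _⟩
  · simp only [Bool.false_eq_true, if_false, map_inv, permHom_band]
    revert i; decide
  · simp only [if_true, permHom_band]

theorem sign_permHom_evalWord (V : Word (Fin 3)) :
    Equiv.Perm.sign (permHom (evalWord band V)) = (-1) ^ V.length := by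
  induction V with
  | nil => simp
  | cons x V ih =>
    rw [evalWord_cons, map_mul, map_mul, ih, permHom_letter, List.length_cons, pow_succ']
    congr 1
    generalize x.1 = i
    revert i; decide

theorem not_fixedPointFree_pow (i : Fin 3) (q : ℕ) : ¬ FixedPointFree (bandSwap i ^ q) := by
  have h : bandSwap i * bandSwap i = 1 := by revert i; decide
  obtain ⟨k, rfl | rfl⟩ := Nat.even_or_odd' q
  · rw [pow_mul, pow_two, h, one_pow]
    decide
  · rw [pow_succ, pow_mul, pow_two, h, one_pow, one_mul]
    revert i; decide

/-- The word of length `m` with cyclically ascending indices that starts with `i`. -/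
def ascending (i : Fin 3) : ℕ → List (Fin 3)
  | 0 => []
  | m + 1 => i :: ascending (i + 1) m

theorem ascending_add (i : Fin 3) (q r : ℕ) :
    ascending i (3 * q + r) = ascending i (3 * q) ++ ascending i r := by
  induction q with
  | zero => simp [ascending]
  | succ q ih =>
    have h : i + 1 + 1 + 1 = i := by omega
    have e1 : 3 * (q + 1) + r = 3 * q + r + 3 := by ring
    have e2 : 3 * (q + 1) = 3 * q + 3 := by ring
    rw [e1, e2]
    simp only [ascending, h, ih, List.cons_append]

/-- Three ascending letters act as one transposition: the outer two conjugate the middle one to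
itself up to relabelling, which is a finite check. -/
theorem permHom_ascending (i : Fin 3) (q : ℕ) :
    permHom (evalWord band (posWord (ascending i (3 * q)))) = bandSwap (i + 1) ^ q := by
  induction q with
  | zero => simp [ascending, posWord]
  | succ q ih =>
    rw [Nat.mul_succ, ascending_add i q 3]
    have e : posWord (ascending i (3 * q) ++ ascending i 3) =
      posWord (ascending i (3 * q)) ++ posWord (ascending i 3) := by simp [posWord]
    rw [e, evalWord_append, map_mul, ih, pow_succ]
    congr 1
    simp only [ascending, posWord, List.map, evalWord_cons, evalWord_nil, map_mul, permHom_band,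
      if_true, mul_one]
    clear ih e
    revert i; decide

/-! ### Shortest words without squares -/

section NoSquare

variable {α : B3}

/-- The excluded case is a descending pair. It equals `delta`, so it can be rewritten to end with
the index of the cyclically next letter, which then cancels or completes a square. A next letter
exists because of `hl`. -/
theorem eq_add_one_of_adjacent (hs : ¬ HasSquare α) {A B : Word (Fin 3)} {k l : Fin 3}
    (h : IsShortestInConjClass (A ++ [(k, true), (l, true)] ++ B) α)
    (hl : A ++ B ≠ []) : l = k + 1 := by
  obtain rfl | rfl | rfl : l = k + 1 ∨ l = k ∨ k = l + 1 := by omega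
  · rfl
  · exact absurd (HasSquare.of_shortest h) hs
  · exfalso
    have h' : IsShortestInConjClass ([(l + 1, true), (l, true)] ++ (B ++ A)) α := by
      have := IsShortestInConjClass.rotate (A := A) (B := [(l + 1, true), (l, true)] ++ B)
        (by simpa using h)
      simpa using this
    rcases hC : B ++ A with _ | ⟨⟨j, e⟩, C⟩
    · simp at hC
      simp [hC] at hl
    · rw [hC] at h'
      cases e
      -- Rewrite `delta` as `a_{j+1} a_j`; the following inverse of `a_j` cancels.
      · have := IsShortestInConjClass.not_shorter (A := [])
          (B := [(l + 1, true), (l, true), (j, false)]) (B' := [(j + 1, true)]) (C := C)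
          (by simpa using h') (by
            have := evalWord_descent l j
            simp at this
            simp [← mul_assoc, this])
        simp at this
      · have := IsShortestInConjClass.replace (A := []) (C := (j, true) :: C)
          h' (evalWord_descent l j) le_rfl
        exact hs (HasSquare.of_shortest (A := [(j + 1, true)]) (B := C) (x := (j, true))
          (by simpa using this))

theorem exists_eq_ascending (hs : ¬ HasSquare α) {A B : Word (Fin 3)} {P : List (Fin 3)}
    (h : IsShortestInConjClass (A ++ posWord P ++ B) α)
    (hl : 3 ≤ (A ++ posWord P ++ B).length) : ∃ i, P = ascending i P.length := by
  induction P generalizing A with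
  | nil => exact ⟨0, rfl⟩
  | cons k P ih =>
    obtain ⟨i, hi⟩ := ih (A := A ++ [(k, true)]) (by simpa [posWord] using h)
      (by simpa [posWord] using hl)
    rcases P with _ | ⟨l, P⟩
    · exact ⟨k, rfl⟩
    · have e := eq_add_one_of_adjacent hs (A := A) (k := k) (l := l) (B := posWord P ++ B)
        (by simpa [posWord] using h) (by
          intro h0
          simp only [posWord, List.append_eq_nil_iff, List.map_eq_nil_iff] at h0
          obtain ⟨rfl, rfl, rfl⟩ := h0
          simp [posWord] at hl)
      simp only [List.length_cons, ascending, List.cons.injEq] at hi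
      obtain ⟨rfl, hi⟩ := hi
      subst e
      exact ⟨k, by simp only [List.length_cons, ascending]; rw [← hi]⟩

/-- The word ascends, so its length mod 3 decides what happens at the cyclic junction: for remainder
1 a square, for remainder 2 a descending pair. Remainder 0 gives a power of a transposition. -/
theorem not_fixedPointFree_of_posWord (hs : ¬ HasSquare α) {P : List (Fin 3)}
    (h : IsShortestInConjClass (posWord P) α) (hl : 3 ≤ P.length) :
    ¬ FixedPointFree (permHom α) := by
  intro hf
  obtain ⟨i, hi⟩ := exists_eq_ascending hs (A := []) (B := []) (P := P) (by simpa using h)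
    (by simpa [posWord] using hl)
  generalize P.length = m at hi hl
  subst hi
  obtain ⟨q, r, hr, rfl⟩ : ∃ q r, r < 3 ∧ m = 3 * q + r :=
    ⟨m / 3, m % 3, Nat.mod_lt _ (by norm_num), (Nat.div_add_mod m 3).symm⟩
  obtain ⟨q, rfl⟩ : ∃ q', q = q' + 1 := ⟨q - 1, by omega⟩
  have e0 : 3 * (q + 1) = 3 * q + 2 + 1 := by ring
  interval_cases r
  · exact not_fixedPointFree_pow (i + 1) (q + 1)
      (permHom_ascending i (q + 1) ▸ hf.of_isConj h.1)
  · rw [ascending_add, e0] at h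
    exact hs (HasSquare.of_shortest (A := []) (x := (i, true))
      (B := posWord (ascending (i + 1) (3 * q + 2))) (by
        have := IsShortestInConjClass.rotate
          (A := posWord (ascending i (3 * q + 2 + 1))) (B := [(i, true)])
          (by simpa [posWord, ascending] using h)
        simpa [posWord, ascending] using this))
  · rw [ascending_add, e0] at h
    have := eq_add_one_of_adjacent hs (A := []) (k := i + 1) (l := i)
      (B := posWord (ascending (i + 1) (3 * q + 2)) ++ [(i, true)]) (by
        have := IsShortestInConjClass.rotate
          (A := posWord (ascending i (3 * q + 2 + 1)) ++ [(i, true)]) (B := [(i + 1, true)])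
          (by simpa [posWord, ascending] using h)
        simpa [posWord, ascending] using this) (by simp)
    omega

/-- Two exchanges move the inverse letter to the front of the ascending pair and leave that pair
unchanged, so the pair then faces the next negative letter. -/
theorem evalWord_pass (k : Fin 3) : evalWord band [(k, true), (k + 1, true), (k, false)] =
    evalWord band [(k + 1, false), (k, true), (k + 1, true)] := by
  have h1 := evalWord_neg_pos (k + 1)
  have h2 := evalWord_neg_pos k
  have e : k + 1 + 2 = k := by omega
  have e' : k + 1 + 1 = k + 2 := by omega
  rw [e, e'] at h1
  have a : [(k, true), (k + 1, true), (k, false)] =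
    [(k, true)] ++ [(k + 1, true), (k, false)] := rfl
  have b : [(k + 1, false), (k, true), (k + 1, true)] =
    [(k + 1, false), (k, true)] ++ [(k + 1, true)] := rfl
  rw [a, b, evalWord_append, evalWord_append, ← h1, h2, ← evalWord_append, ← evalWord_append]
  rfl

/-- Passing the inverse letter leftwards changes `a_{k+1}` into a second `a_k`. -/
theorem evalWord_square (k : Fin 3) : evalWord band [(k, true), (k + 1, true), (k + 2, false)] =
    evalWord band [(k + 1, false), (k, true), (k, true)] := by
  have h1 := evalWord_neg_pos' (k + 2)
  have h2 := evalWord_neg_pos k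
  have e : k + 2 + 1 = k := by omega
  have e' : k + 2 + 2 = k + 1 := by omega
  rw [e, e'] at h1
  have a : [(k, true), (k + 1, true), (k + 2, false)] =
    [(k, true)] ++ [(k + 1, true), (k + 2, false)] := rfl
  have b : [(k + 1, false), (k, true), (k, true)] =
    [(k + 1, false), (k, true)] ++ [(k, true)] := rfl
  rw [a, b, evalWord_append, evalWord_append, ← h1, h2, ← evalWord_append, ← evalWord_append]
  rfl

theorem evalWord_square' (k : Fin 3) :
    evalWord band [(k, false), (k + 1, true), (k + 2, true)] =
      evalWord band [(k + 2, true), (k + 2, true), (k + 1, false)] := by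
  have h1 := evalWord_neg_pos' k
  have h2 := evalWord_neg_pos (k + 2)
  have e : k + 2 + 1 = k := by omega
  have e' : k + 2 + 2 = k + 1 := by omega
  rw [e, e'] at h2
  have a : [(k, false), (k + 1, true), (k + 2, true)] =
    [(k, false), (k + 1, true)] ++ [(k + 2, true)] := rfl
  have b : [(k + 2, true), (k + 2, true), (k + 1, false)] =
    [(k + 2, true)] ++ [(k + 2, true), (k + 1, false)] := rfl
  rw [a, b, evalWord_append, evalWord_append, h1, ← h2, ← evalWord_append, ← evalWord_append]
  rfl

/-- Without squares, a negative letter after an ascending pair `a_k a_{k+1}` is the inverse of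
`a_k`. -/
theorem eq_of_pos_pos_neg (hs : ¬ HasSquare α) {A B : Word (Fin 3)} {k j : Fin 3}
    (h : IsShortestInConjClass (A ++ [(k, true), (k + 1, true), (j, false)] ++ B) α) : j = k := by
  obtain rfl | rfl | rfl : j = k ∨ j = k + 1 ∨ j = k + 2 := by omega
  · rfl
  · have := IsShortestInConjClass.not_shorter (A := A ++ [(k, true)]) (C := B)
      (by simpa using h) (evalWord_cancel (k + 1) true)
    simp at this
  · have := h.replace (evalWord_square k) le_rfl
    exact absurd (HasSquare.of_shortest (A := A ++ [(k + 1, false)]) (x := (k, true)) (B := B)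
      (by simpa using this)) hs

/-- The last two positive letters are `a_j a_{j+1}`, and they force the first negative index to be
`j`. A second negative letter is impossible: `evalWord_pass` would force it to have index `j` too, a
square. With a single negative letter, the cyclic junction in front of `P` fixes the first positive
index as well. -/
theorem not_fixedPointFree_of_mixed (hs : ¬ HasSquare α) {P N : List (Fin 3)}
    (h : IsShortestInConjClass (posWord P ++ negWord N) α) (hl : 4 ≤ P.length + N.length)
    (hP : 2 ≤ P.length) (hN : N ≠ []) : ¬ FixedPointFree (permHom α) := by
  intro hf
  obtain ⟨P₀, k, l, rfl⟩ : ∃ P₀ k l, P = P₀ ++ [k, l] := by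
    rcases List.eq_nil_or_concat P with rfl | ⟨P₁, l, rfl⟩
    · simp at hP
    · rcases List.eq_nil_or_concat P₁ with rfl | ⟨P₂, k, rfl⟩
      · simp at hP
      · exact ⟨P₂, k, l, by simp⟩
  obtain ⟨j, N, rfl⟩ := List.exists_cons_of_ne_nil hN
  obtain rfl := eq_add_one_of_adjacent hs (A := posWord P₀) (B := negWord (j :: N))
    (k := k) (l := l) (by simpa [posWord] using h) (by simp [negWord])
  obtain rfl : j = k := eq_of_pos_pos_neg hs (A := posWord P₀) (B := negWord N)
    (by simpa [posWord, negWord] using h)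
  rcases N with _ | ⟨l, N⟩
  · obtain ⟨i, hi⟩ := exists_eq_ascending hs (A := []) (B := negWord [j])
      (P := P₀ ++ [j, j + 1]) (by simpa using h) (by simp [posWord, negWord])
    generalize hm : (P₀ ++ [j, j + 1]).length = m at hi hl
    obtain ⟨q, r, hr, rfl⟩ : ∃ q r, r < 3 ∧ m = 3 * q + r :=
      ⟨m / 3, m % 3, Nat.mod_lt _ (by norm_num), (Nat.div_add_mod m 3).symm⟩
    obtain ⟨q, rfl⟩ : ∃ q', q = q' + 1 := ⟨q - 1, by simp at hl; omega⟩
    have e0 : 3 * (q + 1) + r = 3 * q + r + 1 + 1 + 1 := by ring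
    have hi' := hi
    rw [e0] at hi
    simp only [ascending] at hi
    rw [hi] at h
    have hrot : IsShortestInConjClass ([(j, false), (i, true), (i + 1, true)] ++
        posWord (ascending (i + 1 + 1) (3 * q + r + 1))) α := by
      have := h.rotate
      simpa [posWord, negWord, ascending] using this
    -- The first positive letter now follows the inverse of `a_j`. The three cases give a
    -- cancellation, a square by `evalWord_square'`, and the one surviving configuration.
    obtain rfl | rfl | rfl : i = j ∨ i = j + 1 ∨ i = j + 2 := by omega
    · have := IsShortestInConjClass.not_shorter (A := [])
        (C := (i + 1, true) :: posWord (ascending (i + 1 + 1) (3 * q + r + 1)))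
        (by simpa using hrot) (evalWord_cancel i false)
      simp at this
    · have e : j + 1 + 1 = j + 2 := by omega
      rw [e] at hrot
      have := IsShortestInConjClass.replace (A := []) (by simpa using hrot)
        (evalWord_square' j) le_rfl
      exact hs (HasSquare.of_shortest (A := []) (x := (j + 2, true)) (by
        simpa using this))
    · have e1 : j + 2 + 1 = j := by omega
      -- Since `P` ends with `j + 1` and starts with `j + 2`, its length is divisible by 3. Then `P`
      -- contributes a power of the transposition of `a_j`, to which the negative letter adds one
      -- more factor.
      interval_cases r
      · rw [← hi, hi'] at h
        have hf' := hf.of_isConj h.1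
        rw [evalWord_append, map_mul, add_zero, permHom_ascending, e1] at hf'
        have : permHom (evalWord band (negWord [j])) = bandSwap j := by
          simpa [negWord] using permHom_letter (j, false)
        rw [this, ← pow_succ] at hf'
        exact not_fixedPointFree_pow _ _ hf'
      · rw [ascending_add] at hi'
        have := congrArg List.getLast? hi'
        simp [ascending] at this
      · rw [ascending_add] at hi'
        have := congrArg List.getLast? hi'
        simp [ascending, e1] at this
  · by_cases hlj : l = j
    · subst hlj
      exact hs (HasSquare.of_shortest (A := posWord (P₀ ++ [l, l + 1])) (x := (l, false))
        (B := negWord N) (by simpa [posWord, negWord] using h))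
    · have h1 := IsShortestInConjClass.replace (A := posWord P₀)
        (C := negWord (l :: N)) (by simpa [posWord, negWord] using h) (evalWord_pass j) le_rfl
      exact hlj (eq_of_pos_pos_neg hs (A := posWord P₀ ++ [(j + 1, false)]) (B := negWord N)
        (by simpa [posWord, negWord] using h1))

theorem not_fixedPointFree_of_two_le (hs : ¬ HasSquare α) {P N : List (Fin 3)}
    (h : IsShortestInConjClass (posWord P ++ negWord N) α) (hl : 4 ≤ P.length + N.length)
    (hP : 2 ≤ P.length) : ¬ FixedPointFree (permHom α) := by
  by_cases hN : N = []
  · subst hN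
    exact not_fixedPointFree_of_posWord hs (P := P) (by simpa [negWord] using h)
      (by simp at hl; omega)
  · exact not_fixedPointFree_of_mixed hs h hl hP hN

end NoSquare

/-! ### Squares in long shortest words, and the two-letter exception. -/

theorem invWord_pos_neg (P N : List (Fin 3)) :
    invWord (posWord P ++ negWord N) = posWord N.reverse ++ negWord P.reverse := by
  simp [invWord, posWord, negWord, List.map_reverse, Function.comp_def]

theorem FixedPointFree.inv {s : Equiv.Perm (Fin 3)} (h : FixedPointFree s) :
    FixedPointFree s⁻¹ := by
  intro k hk
  exact h k (Equiv.Perm.inv_eq_iff_eq.1 hk).symm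

theorem hasSquare_of_four_le {α : B3} {V : Word (Fin 3)} (h : IsShortestInConjClass V α)
    (hl : 4 ≤ V.length) (hf : FixedPointFree (permHom α)) : HasSquare α := by
  obtain ⟨P, N, h1, h2⟩ := exists_sorted V
  have h3 : (posWord P ++ negWord N).length = P.length + N.length := by simp [posWord, negWord]
  have h' := h.of_isConj (V' := posWord P ++ negWord N) (by rw [h1]) (h3 ▸ h2)
  have h4 := h.2 _ h'.1
  rw [h3] at h4
  by_contra hs
  -- One of the two parts has at least two letters; if it is the negative one, invert the braid.
  rcases le_or_gt 2 P.length with hP | hP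
  · exact not_fixedPointFree_of_two_le hs h' (by omega) hP hf
  · have hi := h'.inv
    rw [invWord_pos_neg] at hi
    refine not_fixedPointFree_of_two_le (fun h => hs h.of_inv) hi (by simp; omega)
      (by simp; omega) ?_
    rw [map_inv]
    exact hf.inv

/-- Equal indices would give the identity permutation. Different indices are cyclically consecutive,
up to exchanging the letters by a rotation, and shifting by `delta` reaches the indices 0 and 1. -/
theorem isConj_two_letters (x y : Fin 3 × Bool)
    (hf : FixedPointFree (permHom (evalWord band [x, y]))) :
    ∃ e f, IsConj (evalWord band [x, y]) (evalWord artin [(0, e), (1, f)]) := by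
  have key : ∀ (i : Fin 3) (e f : Bool),
      IsConj (evalWord band [(i, e), (i + 1, f)]) (evalWord artin [(0, e), (1, f)]) := by
    intro i e f
    have h0 : evalWord artin [(0, e), (1, f)] = evalWord band [(0, e), (1, f)] := by
      simp [band]
    rw [h0]
    fin_cases i
    · exact IsConj.refl _
    · exact isConj_shiftWord [(1, e), (2, f)]
    · exact (isConj_shiftWord [(2, e), (0, f)]).trans (isConj_shiftWord [(1, e), (2, f)])
  obtain ⟨i, e⟩ := x
  obtain ⟨j, f⟩ := y
  obtain rfl | rfl | rfl : i = j ∨ j = i + 1 ∨ i = j + 1 := by omega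
  · exfalso
    rw [evalWord_cons, evalWord_cons, map_mul, map_mul, permHom_letter, permHom_letter] at hf
    revert hf
    simp only [evalWord_nil, map_one]
    clear e f
    revert i
    decide
  · exact ⟨e, f, key i e f⟩
  · refine ⟨f, e, IsConj.trans ?_ (key j f e)⟩
    simpa using isConj_mul_comm (evalWord band [(j + 1, e)]) (evalWord band [(j, f)])

theorem exists_isShortest (w : Word (Fin 2)) :
    ∃ V, IsShortestInConjClass V (evalWord artin w) := by
  have h0 : ∃ n, ∃ V : Word (Fin 3), V.length = n ∧ IsConj (evalWord artin w) (evalWord band V) := by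
    refine ⟨_, w.map fun x => (x.1.castSucc, x.2), rfl, ?_⟩
    have hb : ∀ i : Fin 2, band i.castSucc = artin i := by
      intro i; fin_cases i <;> rfl
    simpa [evalWord, Function.comp_def, hb] using IsConj.refl (evalWord artin w)
  classical
  obtain ⟨V, hV, hc⟩ := Nat.find_spec h0
  exact ⟨V, hc, fun V' hV' => hV ▸ Nat.find_min' h0 ⟨V', rfl, hV'⟩⟩

theorem hasSquare_or_isConj (w : Word (Fin 2))
    (hf : FixedPointFree (permHom (evalWord artin w))) :
    HasSquare (evalWord artin w) ∨
      ∃ e f, IsConj (evalWord artin w) (evalWord artin [(0, e), (1, f)]) := by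
  obtain ⟨V, hV⟩ := exists_isShortest w
  rcases le_or_gt 4 V.length with hl | hl
  · exact Or.inl (hasSquare_of_four_le hV hl hf)
  · right
    have hf' := hf.of_isConj hV.1
    have hsign := sign_permHom_evalWord V
    -- A 3-cycle is even while each letter is odd, which rules out one and three letters.
    have : ∀ s, FixedPointFree s → Equiv.Perm.sign s = 1 := by decide
    rw [this _ hf'] at hsign
    rcases V with _ | ⟨x, _ | ⟨y, _ | ⟨z, V⟩⟩⟩
    · simp only [evalWord_nil, map_one] at hf'
      exact absurd hf' (by decide)
    · simp at hsign
    · obtain ⟨e, f, h⟩ := isConj_two_letters x y hf'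
      exact ⟨e, f, hV.1.trans h⟩
    · have : V = [] := by
        rw [← List.length_eq_zero_iff]; simp at hl; omega
      subst this
      simp [pow_succ] at hsign

open Topology unitInterval

/-! ### Ambient isotopies -/

/-- The family need not start at the identity: composing with the inverse of `Ψ 0` normalises it. -/
theorem AmbientIsotopic.of_family (Ψ : I → (E3 ≃ₜ E3))
    (hΨ : Continuous fun p : I × E3 => Ψ p.1 p.2) (K : Set E3) :
    AmbientIsotopic (Ψ 0 '' K) (Ψ 1 '' K) := by
  refine ⟨fun s => (Ψ 0).symm.trans (Ψ s), ?_, fun x => by simp, ?_⟩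
  · exact hΨ.comp (continuous_fst.prodMk ((Ψ 0).symm.continuous.comp continuous_snd))
  · rw [← Set.image_comp]
    congr 1
    ext x
    simp

theorem AmbientIsotopic.symm {K L : Set E3} (h : AmbientIsotopic K L) : AmbientIsotopic L K := by
  obtain ⟨H, hc, h0, rfl⟩ := h
  have := AmbientIsotopic.of_family (fun s => H (σ s))
    (hc.comp ((continuous_symm.comp continuous_fst).prodMk continuous_snd)) K
  have e : H 0 '' K = K := by
    rw [show ⇑(H 0) = id from funext h0, Set.image_id]
  simpa [e] using this

theorem AmbientIsotopic.trans {K L M : Set E3} (h : AmbientIsotopic K L)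
    (h' : AmbientIsotopic L M) : AmbientIsotopic K M := by
  obtain ⟨H, hc, h0, rfl⟩ := h
  obtain ⟨H', hc', h0', rfl⟩ := h'
  refine ⟨fun s => (H s).trans (H' s), hc'.comp (continuous_fst.prodMk hc), fun x => ?_, ?_⟩
  · simp [h0, h0']
  · rw [← Set.image_comp]; rfl

/-- The bound `hC` makes each `h s` proper, hence closed, so a continuous bijection is already a
homeomorphism. -/
theorem AmbientIsotopic.of_bijective (h : I → E3 → E3)
    (hc : Continuous fun p : I × E3 => h p.1 p.2) (hb : ∀ s, Function.Bijective (h s))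
    (h0 : ∀ x, h 0 x = x) (C : ℝ) (hC : ∀ s x, ‖x‖ ≤ ‖h s x‖ + C) (K : Set E3) :
    AmbientIsotopic K (h 1 '' K) := by
  have hcs : ∀ s, Continuous (h s) := fun s => hc.comp (by fun_prop : Continuous fun x => (s, x))
  have hp : ∀ s, IsProperMap (h s) := by
    intro s
    rw [isProperMap_iff_tendsto_cocompact]
    refine ⟨hcs s, ?_⟩
    rw [← Metric.cobounded_eq_cocompact, ← tendsto_norm_atTop_iff_cobounded]
    refine Filter.tendsto_atTop_mono (f := fun x => ‖x‖ - C) (fun x => by linarith [hC s x]) ?_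
    exact Filter.tendsto_atTop_add_const_right _ _ tendsto_norm_cobounded_atTop
  exact ⟨fun s => (Equiv.ofBijective (h s) (hb s)).toHomeomorphOfContinuousClosed (hcs s)
    (hp s).isClosedMap, hc, h0, rfl⟩

/-! ### The solid torus -/

/-- The closed half-plane in which the section of the solid torus lies. -/
abbrev HalfPlane : Type := {z : ℂ // -2 ≤ z.re}

theorem continuous_torusPoint : Continuous fun q : ℝ × ℂ => torusPoint q.1 q.2 := by
  unfold torusPoint
  refine (PiLp.continuous_toLp 2 _).comp (continuous_pi fun i => ?_)
  fin_cases i <;> simp <;> fun_prop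

theorem norm_torusPoint (θ : ℝ) (z : ℂ) : ‖torusPoint θ z‖ = ‖2 + z‖ := by
  rw [EuclideanSpace.norm_eq, Complex.norm_def, Complex.normSq_apply, Fin.sum_univ_three]
  congr 1
  simp [torusPoint, mul_pow, sq_abs]
  linear_combination (2 + z.re) ^ 2 * Real.sin_sq_add_cos_sq (2 * Real.pi * θ)

theorem torusPoint_one (z : ℂ) : torusPoint 1 z = torusPoint 0 z := by
  simp [torusPoint]

/-- Cylindrical coordinates are ambiguous only on the axis and at the seam between the angles 0 and
2π. -/
theorem torusPoint_inj {t t' : ℝ} (ht : t ∈ I) (ht' : t' ∈ I) {z z' : ℂ} (hz : -2 ≤ z.re)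
    (hz' : -2 ≤ z'.re) (h : torusPoint t z = torusPoint t' z') :
    z = z' ∧ (z.re = -2 ∨ t = t' ∨ (t = 0 ∧ t' = 1) ∨ (t = 1 ∧ t' = 0)) := by
  have e0 := congrFun (congrArg WithLp.ofLp h) 0
  have e1 := congrFun (congrArg WithLp.ofLp h) 1
  have e2 := congrFun (congrArg WithLp.ofLp h) 2
  simp [torusPoint] at e0 e1 e2
  have hre : z.re = z'.re := by
    have h1 := Real.sin_sq_add_cos_sq (2 * Real.pi * t)
    have h2 := Real.sin_sq_add_cos_sq (2 * Real.pi * t')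
    have : (2 + z.re) ^ 2 = (2 + z'.re) ^ 2 := by
      calc (2 + z.re) ^ 2 = ((2 + z.re) * Real.cos (2 * Real.pi * t)) ^ 2 +
            ((2 + z.re) * Real.sin (2 * Real.pi * t)) ^ 2 := by
              linear_combination -(2 + z.re) ^ 2 * h1
        _ = (2 + z'.re) ^ 2 := by rw [e0, e1]; linear_combination (2 + z'.re) ^ 2 * h2
    have := (sq_eq_sq₀ (by linarith) (by linarith)).1 this
    linarith
  refine ⟨Complex.ext hre e2, ?_⟩
  by_cases h2 : z.re = -2
  · exact Or.inl h2
  right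
  have hne : 2 + z.re ≠ 0 := fun h => h2 (by linarith)
  rw [← hre] at e0 e1
  have c := mul_left_cancel₀ hne e0
  have s := mul_left_cancel₀ hne e1
  obtain ⟨k, hk⟩ := Real.Angle.angle_eq_iff_two_pi_dvd_sub.1 (Real.Angle.cos_sin_inj c s)
  have hk' : t - t' = k := by
    have : 2 * Real.pi * (t - t' - k) = 0 := by linear_combination hk
    have := (mul_eq_zero.1 this).resolve_left (by positivity)
    linarith
  have k1 : (k : ℝ) ≤ 1 := by rw [← hk']; linarith [ht.2, ht'.1]
  have k2 : (-1 : ℝ) ≤ k := by rw [← hk']; linarith [ht.1, ht'.2]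
  have k1' : k ≤ 1 := by exact_mod_cast k1
  have k2' : -1 ≤ k := by exact_mod_cast k2
  obtain rfl | rfl | rfl : k = -1 ∨ k = 0 ∨ k = 1 := by omega
  · right; left
    push_cast at hk'
    constructor <;> linarith [ht.1, ht'.2]
  · left
    push_cast at hk'
    linarith
  · right; right
    push_cast at hk'
    constructor <;> linarith [ht.2, ht'.1]

theorem exists_torusPoint_eq (p : E3) : ∃ (t : I) (z : HalfPlane), torusPoint t z = p := by
  set w : ℂ := ⟨p 0, p 1⟩ with hw
  have hz : (-2 : ℝ) ≤ (⟨‖w‖ - 2, p 2⟩ : ℂ).re := by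
    have := norm_nonneg w
    simp
  have key : ∀ φ : ℝ, ‖w‖ * Real.cos φ = p 0 → ‖w‖ * Real.sin φ = p 1 →
      torusPoint (φ / (2 * Real.pi)) ⟨‖w‖ - 2, p 2⟩ = p := by
    intro φ h0 h1
    have e : 2 * Real.pi * (φ / (2 * Real.pi)) = φ := by field_simp
    ext i
    fin_cases i <;> simp [torusPoint, e, h0, h1]
  have hc : ‖w‖ * Real.cos w.arg = p 0 := Complex.norm_mul_cos_arg w
  have hs : ‖w‖ * Real.sin w.arg = p 1 := Complex.norm_mul_sin_arg w
  have hpi := Real.pi_pos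
  rcases le_or_gt 0 w.arg with h | h
  · refine ⟨⟨w.arg / (2 * Real.pi), by positivity, ?_⟩, ⟨_, hz⟩, key _ hc hs⟩
    rw [div_le_one (by positivity)]
    linarith [Complex.arg_le_pi w]
  · refine ⟨⟨(w.arg + 2 * Real.pi) / (2 * Real.pi), ?_, ?_⟩, ⟨_, hz⟩, key _ ?_ ?_⟩
    · have := Complex.neg_pi_lt_arg w
      exact div_nonneg (by linarith) (by positivity)
    · rw [div_le_one (by positivity)]
      linarith
    · rwa [Real.cos_add_two_pi]
    · rwa [Real.sin_add_two_pi]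

theorem isProperMap_torusPoint : IsProperMap fun q : I × HalfPlane => torusPoint q.1 q.2 := by
  have hc : Continuous fun q : I × HalfPlane => torusPoint q.1 q.2 :=
    continuous_torusPoint.comp (f := fun q : I × HalfPlane => ((q.1 : ℝ), (q.2 : ℂ))) (by fun_prop)
  rw [isProperMap_iff_isCompact_preimage]
  refine ⟨hc, fun K hK => ?_⟩
  obtain ⟨R, hR⟩ := hK.isBounded.exists_norm_le
  have hcl : IsClosed {z : ℂ | -2 ≤ z.re} := isClosed_le continuous_const Complex.continuous_re
  have hcomp : IsCompact ((Subtype.val : HalfPlane → ℂ) ⁻¹' Metric.closedBall (-2) R) :=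
    hcl.isClosedEmbedding_subtypeVal.isCompact_preimage (isCompact_closedBall _ _)
  refine (isCompact_univ.prod hcomp).of_isClosed_subset (hK.isClosed.preimage hc) ?_
  rintro ⟨t, z⟩ h
  have := hR _ h
  rw [norm_torusPoint] at this
  simpa [dist_eq_norm, add_comm] using this

/-- The union of the sets `S t` in the sections of the solid torus at the angles `2πt`. -/
def torusClosure (S : I → Set ℂ) : Set E3 := {p | ∃ t : I, ∃ z ∈ S t, p = torusPoint t z}

/-- Solving `z + g z = w` means finding a fixed point of the contraction `z ↦ w - g z`. -/
theorem bijective_add_of_lipschitzWith {g : ℂ → ℂ} {c : NNReal} (hc : c < 1)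
    (hg : LipschitzWith c g) : Function.Bijective fun z => z + g z := by
  constructor
  · intro z w h
    have h1 : z - w = g w - g z := by simp only at h; linear_combination h
    have h2 := hg.dist_le_mul w z
    rw [dist_eq_norm, dist_eq_norm, ← h1, norm_sub_rev w z] at h2
    have h3 : (c : ℝ) < 1 := by exact_mod_cast hc
    have h4 := norm_nonneg (z - w)
    have : ‖z - w‖ = 0 := by nlinarith
    exact sub_eq_zero.1 (norm_eq_zero.1 this)
  · intro w
    have hf : ContractingWith c fun z => w - g z := by
      refine ⟨hc, ?_⟩
      refine LipschitzWith.of_dist_le_mul fun x y => ?_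
      rw [dist_sub_left]
      exact hg.dist_le_mul x y
    refine ⟨hf.fixedPoint _, ?_⟩
    have := hf.fixedPoint_isFixedPt
    have h : w - g (hf.fixedPoint _) = hf.fixedPoint _ := this
    simp only
    linear_combination -h

/-- A periodic family of contracting displacements of the half-plane sections, supported in the
interior of the half-plane, gives an ambient isotopy. -/
theorem ambientIsotopic_torusClosure_push (D : I → ℂ → ℂ)
    (hD : Continuous fun q : I × ℂ => D q.1 q.2) (h01 : D 0 = D 1) {c : NNReal} (hc : c < 1)
    (hL : ∀ t, LipschitzWith c (D t)) (hv : ∀ t z, z.re ≤ -2 → D t z = 0) {C : ℝ}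
    (hC : ∀ t z, ‖D t z‖ ≤ C) (S : I → Set ℂ) (hS : ∀ t, ∀ z ∈ S t, -2 ≤ z.re) :
    AmbientIsotopic (torusClosure S) (torusClosure fun t => (fun z => z + D t z) '' S t) := by
  let f : I → I → ℂ → ℂ := fun u t z => z + (u : ℝ) • D t z
  have hfb : ∀ u t, Function.Bijective (f u t) := by
    intro u t
    refine bijective_add_of_lipschitzWith hc (LipschitzWith.of_dist_le_mul fun x y => ?_)
    rw [dist_smul₀, Real.norm_of_nonneg u.2.1]
    exact (mul_le_of_le_one_left dist_nonneg u.2.2).trans ((hL t).dist_le_mul x y)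
  have hfv : ∀ u t z, z.re ≤ -2 → f u t z = z := fun u t z h => by simp [f, hv t z h]
  -- The injective map `f u t` fixes every point outside the open half-plane, so no other point can
  -- land there.
  have hfH : ∀ u t z, -2 ≤ (z : ℂ).re → -2 ≤ (f u t z).re := by
    intro u t z hz
    by_contra hlt
    have := (hfb u t).1 (hfv u t _ (not_le.1 hlt).le)
    rw [this] at hlt
    exact hlt hz
  have hf01 : ∀ u, f u 0 = f u 1 := fun u => by simp only [f, h01]
  have hfre : ∀ u t z, -2 ≤ (z : ℂ).re → (f u t z).re = -2 → f u t z = z := by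
    intro u t z hz h
    exact (hfb u t).1 (hfv u t _ h.le)
  choose τ ζ hτζ using exists_torusPoint_eq
  let h : I → E3 → E3 := fun u p => torusPoint (τ p) (f u (τ p) (ζ p))
  have hwd : ∀ u (t t' : I) (z z' : ℂ), -2 ≤ z.re → -2 ≤ z'.re →
      torusPoint t z = torusPoint t' z' →
      torusPoint t (f u t z) = torusPoint t' (f u t' z') := by
    intro u t t' z z' hz hz' he
    obtain ⟨rfl, h | h | ⟨h, h'⟩ | ⟨h, h'⟩⟩ := torusPoint_inj t.2 t'.2 hz hz' he
    · rw [hfv _ _ _ h.le, hfv _ _ _ h.le, he]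
    · rw [Subtype.ext h]
    · obtain rfl : t = 0 := Subtype.ext h
      obtain rfl : t' = 1 := Subtype.ext h'
      rw [hf01]
      simp [torusPoint_one]
    · obtain rfl : t = 1 := Subtype.ext h
      obtain rfl : t' = 0 := Subtype.ext h'
      rw [hf01]
      simp [torusPoint_one]
  have hval : ∀ u (t : I) (z : ℂ), -2 ≤ z.re → h u (torusPoint t z) = torusPoint t (f u t z) :=
    fun u t z hz => hwd u _ _ _ _ (ζ _).2 hz (hτζ _)
  have hcont : Continuous fun p : I × E3 => h p.1 p.2 := by
    -- Properness survives the product with `I`, and a proper surjection is a quotient map.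
    -- Continuity can therefore be checked in the coordinates, where `τ` and `ζ`, which are merely
    -- chosen, disappear.
    have hq : IsQuotientMap (Prod.map (id : I → I)
        fun q : I × HalfPlane => torusPoint q.1 q.2) := by
      have hp := isProperMap_id (X := I).prodMap isProperMap_torusPoint
      refine hp.isClosedMap.isQuotientMap hp.continuous ?_
      refine Function.surjective_id.prodMap fun p => ?_
      obtain ⟨t, z, h⟩ := exists_torusPoint_eq p
      exact ⟨(t, z), h⟩
    rw [hq.continuous_iff]
    have : ((fun p : I × E3 => h p.1 p.2) ∘ Prod.map (id : I → I)
        fun q : I × HalfPlane => torusPoint q.1 q.2) =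
        fun q : I × I × HalfPlane => torusPoint q.2.1 (f q.1 q.2.1 q.2.2) :=
      funext fun q => hval _ _ _ q.2.2.2
    rw [this]
    refine continuous_torusPoint.comp
      (f := fun q : I × I × HalfPlane => ((q.2.1 : ℝ), f q.1 q.2.1 q.2.2)) ?_
    refine Continuous.prodMk (by fun_prop) ?_
    have hD' : Continuous fun q : I × I × HalfPlane => D q.2.1 q.2.2 :=
      hD.comp (f := fun q : I × I × HalfPlane => (q.2.1, (q.2.2 : ℂ))) (by fun_prop)
    exact (continuous_subtype_val.comp (continuous_snd.comp continuous_snd)).add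
      ((continuous_subtype_val.comp continuous_fst).smul hD')
  have hbij : ∀ u, Function.Bijective (h u) := by
    intro u
    constructor
    · intro p p' he
      rw [← hτζ p, ← hτζ p'] at he ⊢
      rw [hval _ _ _ (ζ p).2, hval _ _ _ (ζ p').2] at he
      obtain ⟨e, h1 | h1 | ⟨h1, h2⟩ | ⟨h1, h2⟩⟩ := torusPoint_inj (τ p).2 (τ p').2
        (hfH _ _ _ (ζ p).2) (hfH _ _ _ (ζ p').2) he
      · rw [hfre _ _ _ (ζ p).2 h1, hfre _ _ _ (ζ p').2 (e ▸ h1)] at he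
        exact he
      · rw [Subtype.ext h1] at e ⊢
        rw [(hfb _ _).1 e]
      · rw [Subtype.ext (a2 := (0 : I)) h1, Subtype.ext (a2 := (1 : I)) h2] at e ⊢
        rw [hf01] at e
        rw [(hfb _ _).1 e]
        simp [torusPoint_one]
      · rw [Subtype.ext (a2 := (1 : I)) h1, Subtype.ext (a2 := (0 : I)) h2] at e ⊢
        rw [hf01] at e
        rw [(hfb _ _).1 e]
        simp [torusPoint_one]
    · intro p
      obtain ⟨z, hz⟩ := (hfb u (τ p)).2 (ζ p)
      have hz2 : -2 ≤ z.re := by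
        by_contra hlt
        have := hfv u (τ p) z (not_le.1 hlt).le
        rw [hz] at this
        rw [← this] at hlt
        exact hlt (ζ p).2
      exact ⟨torusPoint (τ p) z, by rw [hval _ _ _ hz2, hz, hτζ]⟩
  have hbd : ∀ u p, ‖p‖ ≤ ‖h u p‖ + C := by
    intro u p
    conv_lhs => rw [← hτζ p]
    simp only [h, norm_torusPoint, f]
    have e : (2 + (ζ p : ℂ)) = (2 + ((ζ p : ℂ) + (u : ℝ) • D (τ p) (ζ p))) -
      (u : ℝ) • D (τ p) (ζ p) := by ring
    have hu : ‖(u : ℝ) • D (τ p) (ζ p)‖ ≤ C := by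
      rw [norm_smul, Real.norm_of_nonneg u.2.1]
      exact (mul_le_of_le_one_left (norm_nonneg _) u.2.2).trans (hC _ _)
    rw [e]
    exact (norm_sub_le _ _).trans (add_le_add le_rfl hu)
  have := AmbientIsotopic.of_bijective h hcont hbij
    (fun p => by simp [h, f, hτζ]) C hbd (torusClosure S)
  convert this using 1
  ext p
  constructor
  · rintro ⟨t, _, ⟨z, hz, rfl⟩, rfl⟩
    exact ⟨_, ⟨t, z, hz, rfl⟩, by rw [hval _ _ _ (hS t z hz)]; simp [f]⟩
  · rintro ⟨_, ⟨t, z, hz, rfl⟩, rfl⟩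
    exact ⟨t, _, ⟨z, hz, rfl⟩, by rw [hval _ _ _ (hS t z hz)]; simp [f]⟩

/-! ### Configurations of three points -/

/-- Ordered configurations of three distinct points in the open half-plane `re > -2`. -/
abbrev Conf : Type := {z : Fin 3 → ℂ // Function.Injective z ∧ ∀ i, -2 < (z i).re}

/-- Relabelling of the points of a configuration. -/
def Conf.relabel (s : Equiv.Perm (Fin 3)) (z : Conf) : Conf :=
  ⟨z.1 ∘ s, z.2.1.comp s.injective, fun i => z.2.2 (s i)⟩

theorem Conf.continuous_relabel (s : Equiv.Perm (Fin 3)) : Continuous (Conf.relabel s) :=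
  continuous_induced_rng.2 (continuous_pi fun i =>
    (continuous_apply (s i)).comp continuous_subtype_val)

/-- Equality of configurations up to relabelling. -/
def confSetoid : Setoid Conf where
  r z z' := ∃ s : Equiv.Perm (Fin 3), z' = z.relabel s
  iseqv :=
    { refl := fun _ => ⟨1, rfl⟩
      symm := by
        rintro z _ ⟨s, rfl⟩
        exact ⟨s⁻¹, Subtype.ext (funext fun i => by simp [Conf.relabel])⟩
      trans := by
        rintro z _ _ ⟨s, rfl⟩ ⟨s', rfl⟩
        exact ⟨s * s', rfl⟩ }

/-- Unordered configurations of three points. -/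
def UConf : Type := Quotient confSetoid

instance : TopologicalSpace UConf := inferInstanceAs (TopologicalSpace (Quotient confSetoid))

namespace UConf

/-- The unordered configuration of an ordered one. -/
def mk (z : Conf) : UConf := Quotient.mk confSetoid z

theorem mk_relabel (s : Equiv.Perm (Fin 3)) (z : Conf) : mk (z.relabel s) = mk z :=
  (Quotient.sound (s := confSetoid) ⟨s, rfl⟩ : mk z = mk (z.relabel s)).symm

theorem continuous_mk : Continuous mk := continuous_quotient_mk'

theorem surjective_mk : Function.Surjective mk := Quotient.mk_surjective

/-- The saturation of an open set is a finite union of its relabellings. Openness matters because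
open quotient maps, unlike general ones, are stable under products. -/
theorem isOpenQuotientMap_mk : IsOpenQuotientMap mk := by
  refine ⟨surjective_mk, continuous_mk, fun U hU => ?_⟩
  have hq : IsQuotientMap mk := isQuotientMap_quotient_mk'
  rw [← hq.isOpen_preimage]
  have : mk ⁻¹' (mk '' U) = ⋃ s : Equiv.Perm (Fin 3), Conf.relabel s ⁻¹' U := by
    ext z
    simp only [Set.mem_preimage, Set.mem_image, Set.mem_iUnion]
    constructor
    · rintro ⟨w, hw, h⟩
      obtain ⟨s, rfl⟩ := Quotient.exact h.symm
      exact ⟨s, hw⟩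
    · rintro ⟨s, hs⟩
      exact ⟨_, hs, mk_relabel s z⟩
  rw [this]
  exact isOpen_iUnion fun s => hU.preimage (Conf.continuous_relabel s)

/-- The set of points of an unordered configuration. -/
def pts : UConf → Set ℂ := Quotient.lift (fun z : Conf => Set.range z.1) (by
  rintro z _ ⟨s, rfl⟩
  exact (s.surjective.range_comp z.1).symm)

@[simp] theorem pts_mk (z : Conf) : pts (mk z) = Set.range z.1 := rfl

end UConf

/-! ### Pushing a configuration to a nearby one -/

/-- A bump of height one that vanishes outside the unit interval. -/
def tent (d : ℝ) : ℝ := max 0 (1 - |d|)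

/-- A cut-off function that is `1` on `[0, 1/8]` and vanishes on `[1/4, ∞)`. -/
def cutoff (d : ℝ) : ℝ := max 0 (min 1 (2 - 8 * d))

/-- The displacement that pushes the points of `z` to the nearby points of `z'`. -/
noncomputable def confPush (r : ℝ) (z z' : Conf) (p : ℂ) : ℂ :=
  ∑ i, ∑ j, (tent (2 * ‖p - z.1 i‖ / r) * cutoff (‖z.1 i - z'.1 j‖ / r)) • (z'.1 j - z.1 i)

theorem confPush_relabel_left (r : ℝ) (z z' : Conf) (s : Equiv.Perm (Fin 3)) :
    confPush r (z.relabel s) z' = confPush r z z' := by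
  funext p
  exact Equiv.sum_comp s fun i => ∑ j, (tent (2 * ‖p - z.1 i‖ / r) *
    cutoff (‖z.1 i - z'.1 j‖ / r)) • (z'.1 j - z.1 i)

theorem confPush_relabel_right (r : ℝ) (z z' : Conf) (s : Equiv.Perm (Fin 3)) :
    confPush r z (z'.relabel s) = confPush r z z' := by
  funext p
  refine Finset.sum_congr rfl fun i _ => ?_
  exact Equiv.sum_comp s fun j => (tent (2 * ‖p - z.1 i‖ / r) *
    cutoff (‖z.1 i - z'.1 j‖ / r)) • (z'.1 j - z.1 i)

/-- The displacement that pushes one unordered configuration to a nearby one. -/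
noncomputable def push (r : ℝ) (x y : UConf) : ℂ → ℂ :=
  Quotient.lift₂ (confPush r) (by
    rintro z z' _ _ ⟨s, rfl⟩ ⟨s', rfl⟩
    rw [confPush_relabel_left, confPush_relabel_right]) x y

theorem push_mk (r : ℝ) (z z' : Conf) : push r (UConf.mk z) (UConf.mk z') = confPush r z z' := rfl

theorem continuous_push (r : ℝ) :
    Continuous fun q : (UConf × UConf) × ℂ => push r q.1.1 q.1.2 q.2 := by
  have hq := (UConf.isOpenQuotientMap_mk.prodMap UConf.isOpenQuotientMap_mk).prodMap
    (IsOpenQuotientMap.id (X := ℂ))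
  rw [← hq.continuous_comp_iff]
  have : (fun q : (UConf × UConf) × ℂ => push r q.1.1 q.1.2 q.2) ∘
      Prod.map (Prod.map UConf.mk UConf.mk) id =
      fun q : (Conf × Conf) × ℂ => confPush r q.1.1 q.1.2 q.2 := rfl
  rw [this]
  unfold confPush tent cutoff
  have h1 : ∀ i, Continuous fun q : (Conf × Conf) × ℂ => q.1.1.1 i := fun i =>
    (continuous_apply i).comp (continuous_subtype_val.comp (continuous_fst.comp continuous_fst))
  have h2 : ∀ i, Continuous fun q : (Conf × Conf) × ℂ => q.1.2.1 i := fun i =>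
    (continuous_apply i).comp (continuous_subtype_val.comp (continuous_snd.comp continuous_fst))
  fun_prop

/-- The points of `z` keep the distance `r` from each other and from the boundary. -/
def Conf.Separated (r : ℝ) (z : Conf) : Prop :=
  (∀ i j, i ≠ j → r < ‖z.1 i - z.1 j‖) ∧ ∀ i, -2 + r < (z.1 i).re

/-- Two unordered configurations that are close to each other compared with the distances of the
points. -/
def Near (r : ℝ) (x y : UConf) : Prop :=
  ∃ z z' : Conf, UConf.mk z = x ∧ UConf.mk z' = y ∧ z.Separated r ∧
    ∀ i, ‖z'.1 i - z.1 i‖ < r / 16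

theorem Conf.isOpen_separated (r : ℝ) : IsOpen {z : Conf | z.Separated r} := by
  have h1 : ∀ i, Continuous fun q : Conf => q.1 i := fun i =>
    (continuous_apply i).comp continuous_subtype_val
  simp only [Conf.Separated, Set.ofPred_and, Set.ofPred_forall]
  refine IsOpen.inter ?_ ?_
  · refine isOpen_iInter_of_finite fun i => isOpen_iInter_of_finite fun j =>
      isOpen_iInter_of_finite fun _ => isOpen_lt continuous_const ((h1 i).sub (h1 j)).norm
  · exact isOpen_iInter_of_finite fun i =>
      isOpen_lt continuous_const (Complex.continuous_re.comp (h1 i))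

theorem isOpen_near (r : ℝ) : IsOpen {q : UConf × UConf | Near r q.1 q.2} := by
  have h1 : ∀ i, Continuous fun q : Conf × Conf => q.1.1 i := fun i =>
    (continuous_apply i).comp (continuous_subtype_val.comp continuous_fst)
  have h2 : ∀ i, Continuous fun q : Conf × Conf => q.2.1 i := fun i =>
    (continuous_apply i).comp (continuous_subtype_val.comp continuous_snd)
  have ho : IsOpen {q : Conf × Conf | q.1.Separated r ∧ ∀ i, ‖q.2.1 i - q.1.1 i‖ < r / 16} := by
    rw [Set.ofPred_and, Set.ofPred_forall]
    exact ((Conf.isOpen_separated r).preimage continuous_fst).inter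
      (isOpen_iInter_of_finite fun i => isOpen_lt ((h2 i).sub (h1 i)).norm continuous_const)
  convert (UConf.isOpenQuotientMap_mk.prodMap UConf.isOpenQuotientMap_mk).isOpenMap _ ho using 1
  ext ⟨x, y⟩
  constructor
  · rintro ⟨z, z', rfl, rfl, h⟩
    exact ⟨(z, z'), h, rfl⟩
  · rintro ⟨⟨z, z'⟩, h, he⟩
    simp only [Prod.map_apply, Prod.mk.injEq] at he
    exact ⟨z, z', he.1, he.2, h⟩

/-! ### Estimates for the push. -/

theorem tent_zero : tent 0 = 1 := by simp [tent]

theorem tent_of_one_le {d : ℝ} (h : 1 ≤ d) : tent d = 0 := by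
  have := le_abs_self d
  exact max_eq_left (by linarith)

theorem tent_nonneg (d : ℝ) : 0 ≤ tent d := le_max_left _ _

theorem tent_le_one (d : ℝ) : tent d ≤ 1 := max_le zero_le_one (by linarith [abs_nonneg d])

theorem abs_tent_sub_le (d d' : ℝ) : |tent d - tent d'| ≤ |d - d'| := by
  refine (abs_max_sub_max_le_max _ _ _ _).trans ?_
  rw [sub_self, abs_zero, sub_sub_sub_cancel_left]
  refine max_le (abs_nonneg _) ?_
  rw [abs_sub_comm d]
  exact abs_abs_sub_abs_le_abs_sub _ _

/-- Summing over all pairs makes the push independent of labels; for near configurations the cut-off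
restores the matching. Partners are closer than `r/16`, where it is 1, and all other pairs are
farther apart than `r - r/16`, where it is 0. -/
theorem confPush_eq {r : ℝ} (hr : 0 < r) {z z' : Conf} (hs : z.Separated r)
    (hn : ∀ i, ‖z'.1 i - z.1 i‖ < r / 16) (p : ℂ) :
    confPush r z z' p = ∑ i, tent (2 * ‖p - z.1 i‖ / r) • (z'.1 i - z.1 i) := by
  refine Finset.sum_congr rfl fun i _ => ?_
  rw [Finset.sum_eq_single i]
  · have : cutoff (‖z.1 i - z'.1 i‖ / r) = 1 := by
      have h1 : ‖z.1 i - z'.1 i‖ / r ≤ 1 / 8 := by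
        rw [div_le_iff₀ hr, norm_sub_rev]
        linarith [hn i]
      rw [cutoff, min_eq_left (by linarith), max_eq_right zero_le_one]
    rw [this, mul_one]
  · intro j _ hij
    have : cutoff (‖z.1 i - z'.1 j‖ / r) = 0 := by
      have h1 : 1 / 4 ≤ ‖z.1 i - z'.1 j‖ / r := by
        rw [le_div_iff₀ hr]
        have h2 := norm_sub_le_norm_sub_add_norm_sub (z.1 i) (z'.1 j) (z.1 j)
        linarith [hs.1 i j hij.symm, hn j]
      rw [cutoff, max_eq_left]
      exact (min_le_right _ _).trans (by linarith)
    rw [this, mul_zero, zero_smul]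
  · simp

/-- Each tent has slope at most `2/r` and multiplies a vector shorter than `r/16`, so three terms
give the constant 3/8. -/
theorem lipschitzWith_push {r : ℝ} (hr : 0 < r) {x y : UConf} (h : Near r x y) :
    LipschitzWith (1 / 2) (push r x y) := by
  obtain ⟨z, z', rfl, rfl, hs, hn⟩ := h
  refine LipschitzWith.of_dist_le_mul fun p q => ?_
  rw [push_mk, confPush_eq hr hs hn, confPush_eq hr hs hn, dist_eq_norm, dist_eq_norm,
    ← Finset.sum_sub_distrib]
  have key : ∀ i, ‖tent (2 * ‖p - z.1 i‖ / r) • (z'.1 i - z.1 i) -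
      tent (2 * ‖q - z.1 i‖ / r) • (z'.1 i - z.1 i)‖ ≤ 1 / 8 * ‖p - q‖ := by
    intro i
    rw [← sub_smul, norm_smul, Real.norm_eq_abs]
    have h1 : |tent (2 * ‖p - z.1 i‖ / r) - tent (2 * ‖q - z.1 i‖ / r)| ≤ 2 / r * ‖p - q‖ := by
      refine (abs_tent_sub_le _ _).trans ?_
      have e : 2 * ‖p - z.1 i‖ / r - 2 * ‖q - z.1 i‖ / r =
        2 / r * (‖p - z.1 i‖ - ‖q - z.1 i‖) := by ring
      rw [e, abs_mul, abs_of_pos (by positivity : 0 < 2 / r)]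
      gcongr
      refine (abs_norm_sub_norm_le _ _).trans ?_
      rw [sub_sub_sub_cancel_right]
    calc _ ≤ 2 / r * ‖p - q‖ * (r / 16) := by gcongr; exact (hn i).le
      _ = _ := by field_simp; ring
  refine (norm_sum_le _ _).trans ((Finset.sum_le_sum fun i _ => key i).trans ?_)
  have := norm_nonneg (p - q)
  simp
  linarith

/-- The tents have radius `r/2`, but their centres are farther than `r` from the boundary line. -/
theorem push_eq_zero {r : ℝ} (hr : 0 < r) {x y : UConf} (h : Near r x y) {p : ℂ}
    (hp : p.re ≤ -2) : push r x y p = 0 := by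
  obtain ⟨z, z', rfl, rfl, hs, hn⟩ := h
  rw [push_mk, confPush_eq hr hs hn]
  refine Finset.sum_eq_zero fun i _ => ?_
  rw [tent_of_one_le, zero_smul]
  rw [le_div_iff₀ hr]
  have := Complex.abs_re_le_norm (p - z.1 i)
  rw [Complex.sub_re] at this
  have h2 := neg_le_abs (p.re - (z.1 i).re)
  linarith [hs.2 i]

theorem norm_push_le {r : ℝ} (hr : 0 < r) {x y : UConf} (h : Near r x y) (p : ℂ) :
    ‖push r x y p‖ ≤ r := by
  obtain ⟨z, z', rfl, rfl, hs, hn⟩ := h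
  rw [push_mk, confPush_eq hr hs hn]
  have key : ∀ i, ‖tent (2 * ‖p - z.1 i‖ / r) • (z'.1 i - z.1 i)‖ ≤ r / 16 := by
    intro i
    rw [norm_smul, Real.norm_of_nonneg (tent_nonneg _)]
    exact (mul_le_of_le_one_left (norm_nonneg _) (tent_le_one _)).trans (hn i).le
  refine (norm_sum_le _ _).trans ((Finset.sum_le_sum fun i _ => key i).trans ?_)
  simp
  linarith

theorem image_push {r : ℝ} (hr : 0 < r) {x y : UConf} (h : Near r x y) :
    (fun p => p + push r x y p) '' x.pts = y.pts := by
  obtain ⟨z, z', rfl, rfl, hs, hn⟩ := h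
  rw [UConf.pts_mk, UConf.pts_mk, push_mk, ← Set.range_comp]
  congr 1
  funext i
  simp only [Function.comp_apply]
  rw [confPush_eq hr hs hn, Finset.sum_eq_single i]
  · simp [tent_zero]
  · intro j _ hij
    rw [tent_of_one_le, zero_smul]
    rw [le_div_iff₀ hr]
    linarith [hs.1 i j hij.symm]
  · simp

/-! ### Homotopy invariance of the closure -/

/-- The closure of a loop of configurations in the solid torus. -/
def loopClosure (γ : I → UConf) : Set E3 := torusClosure fun t => (γ t).pts

theorem ambientIsotopic_of_near {γ γ' : I → UConf} (hγ : Continuous γ) (hγ' : Continuous γ')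
    (h : γ 0 = γ 1) (h' : γ' 0 = γ' 1) {r : ℝ} (hr : 0 < r) (hn : ∀ t, Near r (γ t) (γ' t)) :
    AmbientIsotopic (loopClosure γ) (loopClosure γ') := by
  have := ambientIsotopic_torusClosure_push (fun t => push r (γ t) (γ' t))
    ((continuous_push r).comp (f := fun q : I × ℂ => ((γ q.1, γ' q.1), q.2)) (by fun_prop))
    (by simp only [h, h']) (c := 1 / 2) (by
      rw [← NNReal.coe_lt_coe]; norm_num)
    (fun t => lipschitzWith_push hr (hn t)) (fun t z hz => push_eq_zero hr (hn t) hz)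
    (fun t z => norm_push_le hr (hn t) z) (fun t => (γ t).pts) (by
      intro t z hz
      obtain ⟨w, -, h, -, -⟩ := hn t
      rw [← h, UConf.pts_mk] at hz
      obtain ⟨i, rfl⟩ := hz
      exact (w.2.2 i).le)
  simpa only [image_push hr (hn _)] using! this

/-- Compactness of `I`: the times at which the separation exceeds `1/(n+1)` form an increasing open
cover. -/
theorem exists_separated {γ : I → UConf} (hγ : Continuous γ) :
    ∃ r, 0 < r ∧ ∀ t, ∃ z : Conf, UConf.mk z = γ t ∧ z.Separated r := by
  let U : ℕ → Set I := fun n => γ ⁻¹' (UConf.mk '' {z : Conf | z.Separated (1 / ((n : ℝ) + 1))})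
  have hU : ∀ n, IsOpen (U n) := fun n =>
    (UConf.isOpenQuotientMap_mk.isOpenMap _ (Conf.isOpen_separated _)).preimage hγ
  have hmono : Monotone U := by
    intro m n hmn t
    rintro ⟨z, hz, hzt⟩
    refine ⟨z, ?_, hzt⟩
    have : (1 : ℝ) / ((n : ℝ) + 1) ≤ 1 / ((m : ℝ) + 1) := by
      have : (m : ℝ) ≤ n := by exact_mod_cast hmn
      gcongr
    exact ⟨fun i j hij => this.trans_lt (hz.1 i j hij), fun i => by linarith [hz.2 i]⟩
  have hcov : (Set.univ : Set I) ⊆ ⋃ n, U n := by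
    intro t _
    obtain ⟨z, hz⟩ := UConf.surjective_mk (γ t)
    have hev : ∀ᶠ r in 𝓝[>] (0 : ℝ), z.Separated r := by
      refine Filter.Eventually.and ?_ ?_
      · refine Filter.eventually_all.2 fun i => Filter.eventually_all.2 fun j => ?_
        by_cases hij : i = j
        · exact Filter.Eventually.of_forall fun r h => absurd hij h
        · have : 0 < ‖z.1 i - z.1 j‖ := norm_pos_iff.2 (sub_ne_zero.2 fun h => hij (z.2.1 h))
          filter_upwards [nhdsWithin_le_nhds (Iio_mem_nhds this)] with r hr _ using hr
      · refine Filter.eventually_all.2 fun i => ?_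
        have : 0 < (z.1 i).re + 2 := by linarith [z.2.2 i]
        filter_upwards [nhdsWithin_le_nhds (Iio_mem_nhds this)] with r hr
        have := Set.mem_Iio.1 hr
        linarith
    have hlim : Filter.Tendsto (fun n : ℕ => 1 / ((n : ℝ) + 1)) Filter.atTop (𝓝[>] 0) :=
      tendsto_nhdsWithin_iff.2 ⟨tendsto_one_div_add_atTop_nhds_zero_nat,
        Filter.Eventually.of_forall fun n => Set.mem_Ioi.2 (by positivity)⟩
    obtain ⟨n, hn⟩ := (hlim.eventually hev).exists
    exact Set.mem_iUnion.2 ⟨n, z, hn, hz⟩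
  obtain ⟨n, hn⟩ := isCompact_univ.elim_directed_cover U hU hcov hmono.directed_le
  refine ⟨1 / ((n : ℝ) + 1), by positivity, fun t => ?_⟩
  obtain ⟨z, hz, h⟩ := hn (Set.mem_univ t)
  exact ⟨z, h, hz⟩

/-- Freely homotopic loops of configurations have ambient isotopic closures. -/
theorem ambientIsotopic_of_freeHomotopy (F : I × I → UConf) (hF : Continuous F)
    (h : ∀ s, F (s, 0) = F (s, 1)) :
    AmbientIsotopic (loopClosure fun t => F (0, t)) (loopClosure fun t => F (1, t)) := by
  have hc : ∀ s, Continuous fun t => F (s, t) := fun s => hF.comp (by fun_prop)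
  let P : I → I → Prop := fun s s' =>
    AmbientIsotopic (loopClosure fun t => F (s, t)) (loopClosure fun t => F (s', t))
  have : Std.Symm P := ⟨fun _ _ h => h.symm⟩
  -- As `I` is connected, it suffices that loops with parameters close to `s` have closures isotopic
  -- to that of the loop at `s`.
  refine PreconnectedSpace.induction₂ P (fun s => ?_) ⟨fun _ _ _ h h' => h.trans h'⟩ 0 1
  obtain ⟨r, hr, hsep⟩ := exists_separated (hc s)
  have key : ∀ᶠ s' in 𝓝 s, ∀ t ∈ (Set.univ : Set I), Near r (F (s, t)) (F (s', t)) := by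
    refine isCompact_univ.eventually_forall_of_forall_eventually fun t _ => ?_
    have hcont : Continuous fun q : I × I => (F (s, q.2), F (q.1, q.2)) := by fun_prop
    refine hcont.continuousAt.eventually ((isOpen_near r).mem_nhds ?_)
    obtain ⟨z, hz, hzs⟩ := hsep t
    exact ⟨z, z, hz, hz, hzs, fun i => by simpa using hr⟩
  filter_upwards [key] with s' hs'
  exact ambientIsotopic_of_near (hc s) (hc s') (h s) (h s') hr fun t => hs' t trivial

/-! ### Strands of a word -/

/-- The resting positions of the three strands. -/
noncomputable def basePts : Fin 3 → ℂ := ![-1, 0, 1]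

/-- The unit vector that describes the progress of a letter. -/
noncomputable def letterPhase (e : Bool) (s : ℝ) : ℂ :=
  Complex.exp (((if e then 1 else -1) * (Real.pi * Real.smoothTransition s) : ℝ) * Complex.I)

/-- The positions during a letter, indexed by the initial positions. -/
noncomputable def letterStrand (x : Fin 2 × Bool) (s : ℝ) : Fin 3 → ℂ :=
  if x.1 = 0 then
    ![-1 / 2 - 1 / 2 * letterPhase x.2 s, -1 / 2 + 1 / 2 * letterPhase x.2 s, 1]
  else ![-1, 1 / 2 - 1 / 2 * letterPhase x.2 s, 1 / 2 + 1 / 2 * letterPhase x.2 s]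

/-- The positions during a word, indexed by the initial positions. -/
noncomputable def strand : Word (Fin 2) → ℝ → Fin 3 → ℂ
  | [], _, k => basePts k
  | x :: w, t, k => if t ≤ 1 then letterStrand x t k else strand w (t - 1) (artinSwap x.1 k)

theorem artinSwap_apply (i : Fin 2) (k : Fin 3) :
    artinSwap i k = if i = 0 then ![1, 0, 2] k else ![0, 2, 1] k := by
  revert i k
  decide

theorem letterPhase_of_nonpos (e : Bool) {s : ℝ} (h : s ≤ 0) : letterPhase e s = 1 := by
  simp [letterPhase, Real.smoothTransition.zero_of_nonpos h]

theorem letterPhase_of_one_le (e : Bool) {s : ℝ} (h : 1 ≤ s) : letterPhase e s = -1 := by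
  cases e <;> simp [letterPhase, Real.smoothTransition.one_of_one_le h, Complex.exp_neg]

theorem norm_letterPhase (e : Bool) (s : ℝ) : ‖letterPhase e s‖ = 1 :=
  Complex.norm_exp_ofReal_mul_I _

theorem letterPhase_re (e : Bool) (s : ℝ) :
    (letterPhase e s).re = Real.cos (Real.pi * Real.smoothTransition s) := by
  rw [letterPhase, Complex.exp_ofReal_mul_I_re]
  cases e <;> simp

theorem letterPhase_im (e : Bool) (s : ℝ) : (letterPhase e s).im =
    (if e then 1 else -1) * Real.sin (Real.pi * Real.smoothTransition s) := by
  rw [letterPhase, Complex.exp_ofReal_mul_I_im]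
  cases e <;> simp

theorem continuous_letterPhase (e : Bool) : Continuous (letterPhase e) := by
  unfold letterPhase
  have := Real.smoothTransition.continuous
  fun_prop

theorem continuous_letterStrand (x : Fin 2 × Bool) (k : Fin 3) :
    Continuous fun s => letterStrand x s k := by
  have := continuous_letterPhase x.2
  unfold letterStrand
  split_ifs <;> fin_cases k <;> simp <;> fun_prop

theorem letterStrand_of_nonpos (x : Fin 2 × Bool) {s : ℝ} (h : s ≤ 0) :
    letterStrand x s = basePts := by
  unfold letterStrand
  rw [letterPhase_of_nonpos _ h]
  funext k
  split_ifs <;> fin_cases k <;> norm_num [basePts]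

theorem letterStrand_of_one_le (x : Fin 2 × Bool) {s : ℝ} (h : 1 ≤ s) (k : Fin 3) :
    letterStrand x s k = basePts (artinSwap x.1 k) := by
  unfold letterStrand
  rw [letterPhase_of_one_le _ h]
  obtain ⟨i, e⟩ := x
  rw [artinSwap_apply]
  fin_cases i <;> fin_cases k <;> norm_num [basePts] <;> rfl

theorem strand_of_nonpos (w : Word (Fin 2)) {t : ℝ} (h : t ≤ 0) : strand w t = basePts := by
  funext k
  rcases w with _ | ⟨x, w⟩
  · rfl
  · rw [strand, if_pos (by linarith), letterStrand_of_nonpos _ h]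

theorem strand_cons_of_le (x : Fin 2 × Bool) (w : Word (Fin 2)) {t : ℝ} (h : t ≤ 1) :
    strand (x :: w) t = letterStrand x t := by
  funext k
  rw [strand, if_pos h]

theorem strand_cons_of_ge (x : Fin 2 × Bool) (w : Word (Fin 2)) {t : ℝ} (h : 1 ≤ t) (k : Fin 3) :
    strand (x :: w) t k = strand w (t - 1) (artinSwap x.1 k) := by
  rcases h.lt_or_eq with h | rfl
  · rw [strand, if_neg h.not_ge]
  · rw [strand_cons_of_le _ _ le_rfl, letterStrand_of_one_le _ le_rfl, sub_self,
      strand_of_nonpos _ le_rfl]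

theorem continuous_strand (w : Word (Fin 2)) (k : Fin 3) : Continuous fun t => strand w t k := by
  induction w generalizing k with
  | nil => exact continuous_const
  | cons x w ih =>
    refine Continuous.if_le (continuous_letterStrand x k)
      ((ih _).comp (continuous_id.sub continuous_const)) continuous_id continuous_const ?_
    rintro t rfl
    rw [letterStrand_of_one_le _ le_rfl]
    simp [strand_of_nonpos]

theorem injective_of_ne {z : Fin 3 → ℂ} (h1 : z 0 ≠ z 1) (h2 : z 0 ≠ z 2) (h3 : z 1 ≠ z 2) :
    Function.Injective z := by
  intro i j h
  fin_cases i <;> fin_cases j <;> simp_all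

theorem injective_letterStrand (x : Fin 2 × Bool) (s : ℝ) :
    Function.Injective (letterStrand x s) := by
  have hn := norm_letterPhase x.2 s
  unfold letterStrand
  generalize letterPhase x.2 s = e at hn ⊢
  have h0 : e ≠ 0 := by rintro rfl; simp at hn
  have h3 : e ≠ 3 := by rintro rfl; norm_num at hn
  have h3' : e ≠ -3 := by rintro rfl; norm_num at hn
  split_ifs
  · refine injective_of_ne (fun h => h0 ?_) (fun h => h3' ?_) (fun h => h3 ?_) <;>
      simp at h
    · linear_combination -h
    · linear_combination -2 * h
    · linear_combination 2 * h
  · refine injective_of_ne (fun h => h3 ?_) (fun h => h3' ?_) (fun h => h0 ?_) <;>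
      simp at h
    · linear_combination 2 * h
    · linear_combination -2 * h
    · linear_combination -h

theorem abs_re_letterStrand_le (x : Fin 2 × Bool) (s : ℝ) (k : Fin 3) :
    |(letterStrand x s k).re| ≤ 1 := by
  have hn := (Complex.abs_re_le_norm (letterPhase x.2 s)).trans (norm_letterPhase x.2 s).le
  rw [abs_le] at hn ⊢
  unfold letterStrand
  split_ifs <;> fin_cases k <;> simp <;> constructor <;> linarith

theorem abs_re_basePts_le (k : Fin 3) : |(basePts k).re| ≤ 1 := by
  fin_cases k <;> simp [basePts]

theorem injective_basePts : Function.Injective basePts := by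
  rw [← letterStrand_of_nonpos (0, true) le_rfl]
  exact injective_letterStrand _ _

theorem abs_re_strand_le (w : Word (Fin 2)) (t : ℝ) (k : Fin 3) : |(strand w t k).re| ≤ 1 := by
  induction w generalizing t k with
  | nil => exact abs_re_basePts_le k
  | cons x w ih =>
    rw [strand]
    split_ifs
    · exact abs_re_letterStrand_le x t k
    · exact ih _ _

theorem injective_strand (w : Word (Fin 2)) (t : ℝ) : Function.Injective (strand w t) := by
  induction w generalizing t with
  | nil => exact injective_basePts
  | cons x w ih =>
    rcases le_total t 1 with h | h
    · rw [strand_cons_of_le _ _ h]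
      exact injective_letterStrand x t
    · rw [show strand (x :: w) t = strand w (t - 1) ∘ artinSwap x.1 from
        funext (strand_cons_of_ge x w h)]
      exact (ih _).comp (artinSwap x.1).injective

/-- The ordered configuration of the strands of a word. -/
noncomputable def strandConf (w : Word (Fin 2)) (t : ℝ) : Conf :=
  ⟨strand w t, injective_strand w t, fun k => by
    linarith [(abs_le.1 (abs_re_strand_le w t k)).1]⟩

theorem continuous_strandConf (w : Word (Fin 2)) : Continuous (strandConf w) :=
  continuous_induced_rng.2 (continuous_pi fun k => continuous_strand w k)

theorem strand_of_length_le (w : Word (Fin 2)) {t : ℝ} (h : w.length ≤ t) (k : Fin 3) :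
    strand w t k = basePts ((permHom (evalWord artin w))⁻¹ k) := by
  induction w generalizing t k with
  | nil => simp [strand]
  | cons x w ih =>
    push_cast [List.length_cons] at h
    have hw : (0 : ℝ) ≤ w.length := Nat.cast_nonneg _
    rw [strand_cons_of_ge _ _ (by linarith), ih (by linarith), evalWord_cons, map_mul, mul_inv_rev,
      Equiv.Perm.mul_apply]
    have hx : (permHom (if x.2 then artin x.1 else (artin x.1)⁻¹))⁻¹ = artinSwap x.1 := by
      have : ∀ i, (artinSwap i)⁻¹ = artinSwap i := by decide
      split_ifs <;> simp [this]
    rw [hx]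

theorem range_vec3 (a b c : ℂ) : Set.range ![a, b, c] = {a, b, c} := by
  ext z
  simp [eq_comm]
  tauto

theorem range_letterStrand (x : Fin 2 × Bool) (s : ℝ) :
    Set.range (letterStrand x s) = letterConfig x s := by
  unfold letterStrand letterConfig letterPhase
  by_cases h : x.1 = 0
  · have e : (-2 * (-1 / 2) : ℂ) = 1 := by norm_num
    simp only [h, if_true, range_vec3, e]
    exact Set.insert_comm _ _ _
  · have e : (-2 * (1 / 2) : ℂ) = -1 := by norm_num
    simp only [h, if_false, range_vec3, e]
    rw [Set.insert_comm, Set.pair_comm, Set.insert_comm (1 / 2 + _)]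

theorem range_strand (w : Word (Fin 2)) (j : ℕ) {s : ℝ} (hs : s ∈ I) :
    Set.range (strand w (j + s)) = wordConfig w j s := by
  induction w generalizing j with
  | nil =>
    exact range_vec3 _ _ _
  | cons x w ih =>
    rcases j with _ | j
    · rw [Nat.cast_zero, zero_add, strand_cons_of_le _ _ hs.2, range_letterStrand]
      rfl
    · have h1 : (1 : ℝ) ≤ (j + 1 : ℕ) + s := by
        push_cast; linarith [hs.1, (Nat.cast_nonneg j : (0 : ℝ) ≤ j)]
      rw [show strand (x :: w) ((j + 1 : ℕ) + s) = strand w (j + s) ∘ artinSwap x.1 from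
        funext fun k => by
          rw [strand_cons_of_ge x w h1]
          congr 1
          push_cast; ring, (artinSwap x.1).surjective.range_comp, ih]
      rfl

/-- The resting configuration. -/
noncomputable def baseConf : UConf := UConf.mk (strandConf [] 0)

theorem mk_eq_of_comp {z z' : Conf} (s : Equiv.Perm (Fin 3)) (h : ∀ k, z'.1 k = z.1 (s k)) :
    UConf.mk z' = UConf.mk z := by
  rw [← UConf.mk_relabel s z]
  congr 1
  exact Subtype.ext (funext h)

/-- The loop of configurations of a word, performed with speed `c`. -/
noncomputable def wordLoop (w : Word (Fin 2)) (c : ℝ) (hc : w.length ≤ c) :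
    Path baseConf baseConf where
  toFun t := UConf.mk (strandConf w (c * t))
  continuous_toFun := UConf.continuous_mk.comp ((continuous_strandConf w).comp (by fun_prop))
  source' := mk_eq_of_comp 1 fun k => by simp [strandConf, strand_of_nonpos]
  target' := mk_eq_of_comp (permHom (evalWord artin w))⁻¹ fun k => by
    change strand w (c * 1) k = strand [] 0 _
    rw [strand_of_length_le w (by rwa [mul_one]), strand]
    rfl

theorem wordLoop_apply (w : Word (Fin 2)) (c : ℝ) (hc : w.length ≤ c) (t : I) :
    wordLoop w c hc t = UConf.mk (strandConf w (c * t)) := rfl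

theorem closedBraid_eq_loopClosure (w : Word (Fin 2)) :
    closedBraid w = loopClosure (wordLoop w (w.length + 1) (by linarith)) := by
  have hn : (0 : ℝ) < w.length + 1 := by positivity
  ext p
  constructor
  · rintro ⟨j, hj, s, hs, z, hz, rfl⟩
    have hj' : (j : ℝ) ≤ w.length := by exact_mod_cast Nat.lt_succ_iff.1 hj
    refine ⟨⟨(j + s) / (w.length + 1), div_nonneg (add_nonneg (Nat.cast_nonneg j) hs.1) hn.le, ?_⟩,
      z, ?_, rfl⟩
    · rw [div_le_one hn]
      linarith [hs.2]
    · rw [← range_strand w j hs] at hz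
      simp only [wordLoop_apply, UConf.pts_mk, strandConf]
      rwa [mul_div_cancel₀ _ hn.ne']
  · rintro ⟨t, z, hz, rfl⟩
    simp only [wordLoop_apply, UConf.pts_mk, strandConf] at hz
    have h0 : 0 ≤ ((w.length : ℝ) + 1) * t := mul_nonneg hn.le t.2.1
    have key : ∃ j : ℕ, j < w.length + 1 ∧ ∃ s ∈ I, ((w.length : ℝ) + 1) * t = j + s := by
      rcases t.2.2.lt_or_eq with h1 | h1
      · refine ⟨⌊((w.length : ℝ) + 1) * t⌋₊, ?_, ((w.length : ℝ) + 1) * t -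
          ⌊((w.length : ℝ) + 1) * t⌋₊, ⟨?_, ?_⟩, by ring⟩
        · rw [Nat.floor_lt h0]
          push_cast
          nlinarith
        · linarith [Nat.floor_le h0]
        · linarith [Nat.lt_floor_add_one (((w.length : ℝ) + 1) * t)]
      -- At `t = 1` the floor would name a sector too many, so this time is the end of the last one.
      · exact ⟨w.length, by omega, 1, ⟨zero_le_one, le_rfl⟩, by rw [h1]; ring⟩
    obtain ⟨j, hj, s, hs, h⟩ := key
    refine ⟨j, hj, s, hs, z, ?_, ?_⟩
    · rw [← range_strand w j hs, ← h]
      exact hz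
    · rw [← h, mul_div_cancel_left₀ _ hn.ne']

/-! ### Loops with homotopic or conjugate classes -/

theorem ambientIsotopic_of_homotopic {b : UConf} {p q : Path b b} (h : p.Homotopic q) :
    AmbientIsotopic (loopClosure p) (loopClosure q) := by
  obtain ⟨F⟩ := h
  have := ambientIsotopic_of_freeHomotopy F F.continuous (fun s => by rw [F.source, F.target])
  simpa using this

/-- The path `K` runs through `p`, `q` and `p` again. Sliding a window of length 1 along it by one
half is a free homotopy from one product to the other. -/
theorem ambientIsotopic_trans_comm {a b : UConf} (p : Path a b) (q : Path b a) :
    AmbientIsotopic (loopClosure (p.trans q)) (loopClosure (q.trans p)) := by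
  let K : ℝ → UConf := fun t => if t ≤ 1 then (p.trans q).extend t else p.extend (2 * (t - 1))
  have hK : Continuous K := by
    refine Continuous.if_le (p.trans q).continuous_extend (p.continuous_extend.comp (by fun_prop))
      continuous_id continuous_const ?_
    rintro t rfl
    simp
  have h1 : ∀ t : ℝ, 1 ≤ t → K t = p.extend (2 * (t - 1)) := by
    intro t ht
    rcases ht.lt_or_eq with h | rfl
    · exact if_neg h.not_ge
    · simp [K]
  have := ambientIsotopic_of_freeHomotopy (fun x => K (x.1 / 2 + x.2)) (hK.comp (by fun_prop)) (by
    intro s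
    have hs := s.2
    simp only [Set.Icc.coe_zero, Set.Icc.coe_one, add_zero]
    rw [h1 ((s : ℝ) / 2 + 1) (by linarith [hs.1])]
    simp only [K]
    rw [if_pos (by linarith [hs.2]), Path.extend_trans_of_le_half _ _ (by linarith [hs.2])]
    congr 1
    ring)
  convert this using 2
  · funext t
    simp only [Set.Icc.coe_zero, zero_div, zero_add, K]
    rw [if_pos t.2.2, Path.extend_extends']
  · funext t
    simp only [Set.Icc.coe_one]
    rw [← Path.extend_extends']
    rcases le_total (t : ℝ) (1 / 2) with h | h
    · rw [Path.extend_trans_of_le_half _ _ h]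
      simp only [K]
      rw [if_pos (by linarith), Path.extend_trans_of_half_le _ _ (by linarith [t.2.1])]
      congr 1
      ring
    · rw [Path.extend_trans_of_half_le _ _ h, h1 _ (by linarith)]
      congr 1
      ring

/-- The class of a loop in the fundamental group. -/
def loopClass {b : UConf} (p : Path b b) : FundamentalGroup UConf b :=
  FundamentalGroup.fromPath (Path.Homotopic.Quotient.mk p)

theorem loopClass_trans {b : UConf} (p q : Path b b) :
    loopClass (p.trans q) = loopClass q * loopClass p := rfl

theorem loopClass_symm {b : UConf} (p : Path b b) : loopClass p.symm = (loopClass p)⁻¹ := rfl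

theorem loopClass_eq {b : UConf} {p q : Path b b} : loopClass p = loopClass q ↔ p.Homotopic q :=
  Path.Homotopic.Quotient.eq

theorem ambientIsotopic_of_isConj {b : UConf} {p q : Path b b}
    (h : IsConj (loopClass p) (loopClass q)) :
    AmbientIsotopic (loopClosure p) (loopClosure q) := by
  obtain ⟨c, hc⟩ := isConj_iff.1 h
  obtain ⟨g, rfl⟩ : ∃ g : Path b b, loopClass g = c := Path.Homotopic.Quotient.mk_surjective c
  -- The loops `p` and `q` are, up to homotopy, the two cyclic orders of the factors `p.trans g` and
  -- `g.symm`.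
  have h1 : (g.symm.trans (p.trans g)).Homotopic q := by
    rw [← loopClass_eq, ← hc]
    simp [loopClass_trans, loopClass_symm]
  have h2 : ((p.trans g).trans g.symm).Homotopic p := by
    rw [← loopClass_eq, loopClass_trans, loopClass_trans, loopClass_symm, inv_mul_cancel_left]
  exact ((ambientIsotopic_of_homotopic h2).symm.trans (ambientIsotopic_trans_comm _ _)).trans
    (ambientIsotopic_of_homotopic h1)

/-! ### The homomorphism to the fundamental group -/

/-- The concatenation is a reparametrisation: `f` runs through the first letter in half the time,
and the rest in the other half. The relabelling of strands by the first letter is invisible in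
unordered configurations. -/
theorem loopClass_wordLoop_cons (x : Fin 2 × Bool) (w : Word (Fin 2)) (c : ℝ) (hc : w.length ≤ c) :
    loopClass (wordLoop (x :: w) (c + 1) (by simpa using hc)) =
      loopClass (wordLoop w c hc) * loopClass (wordLoop [x] 1 (by simp)) := by
  rw [← loopClass_trans]
  symm
  have hc0 : 0 ≤ c := (Nat.cast_nonneg _).trans hc
  have hc1 : 0 < c + 1 := by linarith
  let f : I → I := fun t => ⟨(min (2 * (t : ℝ)) 1 + c * max 0 (2 * (t : ℝ) - 1)) / (c + 1), by
    have := t.2.1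
    have h1 : 0 ≤ min (2 * (t : ℝ)) 1 := le_min (by linarith) zero_le_one
    have h2 : 0 ≤ c * max 0 (2 * (t : ℝ) - 1) := mul_nonneg hc0 (le_max_left _ _)
    positivity, by
    have := t.2.2
    rw [div_le_one hc1]
    have h1 : min (2 * (t : ℝ)) 1 ≤ 1 := min_le_right _ _
    have h2 : c * max 0 (2 * (t : ℝ) - 1) ≤ c * 1 :=
      mul_le_mul_of_nonneg_left (max_le zero_le_one (by linarith)) hc0
    linarith⟩
  have hf : Continuous f := Continuous.subtype_mk (by fun_prop) _
  have f0 : f 0 = 0 := Subtype.ext (by simp [f])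
  have f1 : f 1 = 1 := Subtype.ext (by
    simp only [f, Set.Icc.coe_one]
    norm_num
    rw [add_comm, div_self hc1.ne'])
  have hr : (wordLoop [x] 1 (by simp)).trans (wordLoop w c hc) =
      (wordLoop (x :: w) (c + 1) (by simpa using hc)).reparam f hf f0 f1 := by
    ext t
    have hft : (c + 1) * (f t : ℝ) = min (2 * (t : ℝ)) 1 + c * max 0 (2 * (t : ℝ) - 1) :=
      mul_div_cancel₀ _ hc1.ne'
    rw [Path.coe_reparam, Function.comp_apply, wordLoop_apply, hft, Path.trans_apply]
    split_ifs with h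
    · rw [wordLoop_apply, min_eq_left (by linarith), max_eq_left (by linarith), mul_zero, add_zero]
      refine mk_eq_of_comp 1 fun k => ?_
      change strand [x] (1 * (2 * (t : ℝ))) k = strand (x :: w) (2 * (t : ℝ)) k
      rw [one_mul, strand_cons_of_le _ _ (by linarith), strand_cons_of_le _ _ (by linarith)]
    · rw [wordLoop_apply, min_eq_right (by linarith), max_eq_right (by linarith)]
      symm
      refine mk_eq_of_comp (artinSwap x.1) fun k => ?_
      have : 0 ≤ c * (2 * (t : ℝ) - 1) := mul_nonneg hc0 (by linarith)
      change strand (x :: w) (1 + c * (2 * (t : ℝ) - 1)) k =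
        strand w (c * (2 * (t : ℝ) - 1)) (artinSwap x.1 k)
      rw [strand_cons_of_ge _ _ (by linarith), add_sub_cancel_left]
  rw [loopClass_eq, hr]
  exact ⟨(Path.Homotopy.reparam _ _ _ _ _).symm⟩

theorem smoothTransition_one_sub (t : ℝ) :
    Real.smoothTransition (1 - t) = 1 - Real.smoothTransition t := by
  have h := (Real.smoothTransition.pos_denom t).ne'
  unfold Real.smoothTransition
  rw [sub_sub_cancel, add_comm (expNegInvGlue (1 - t))]
  field_simp
  ring

theorem letterPhase_one_sub (e : Bool) (t : ℝ) : letterPhase (!e) (1 - t) = -letterPhase e t := by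
  apply Complex.ext
  · rw [Complex.neg_re, letterPhase_re, letterPhase_re, smoothTransition_one_sub, mul_sub, mul_one,
      Real.cos_pi_sub]
  · rw [Complex.neg_im, letterPhase_im, letterPhase_im, smoothTransition_one_sub, mul_sub, mul_one,
      Real.sin_pi_sub]
    cases e <;> simp

/-- The time change is symmetric about 1/2, so the reversed half turn is literally the opposite
letter with the two moving strands exchanged. -/
theorem wordLoop_inverse (i : Fin 2) :
    wordLoop [(i, false)] 1 (by simp) = (wordLoop [(i, true)] 1 (by simp)).symm := by
  ext t
  rw [Path.symm_apply, Function.comp_apply, wordLoop_apply, wordLoop_apply]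
  refine mk_eq_of_comp (artinSwap i) fun k => ?_
  change strand [(i, false)] (1 * t) k = strand [(i, true)] (1 * (σ t : I)) (artinSwap i k)
  have ht := t.2
  rw [one_mul, one_mul, coe_symm_eq, strand_cons_of_le _ _ ht.2,
    strand_cons_of_le _ _ (by linarith [ht.1])]
  have e := letterPhase_one_sub false t
  rw [Bool.not_false] at e
  simp only [letterStrand, e, artinSwap_apply]
  fin_cases i <;> fin_cases k <;> simp <;> ring

theorem loopClass_wordLoop_nil (c : ℝ) (hc : ([] : Word (Fin 2)).length ≤ c) :
    loopClass (wordLoop [] c hc) = 1 := by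
  have : wordLoop [] c hc = Path.refl baseConf := by
    ext t
    rfl
  rw [this]
  rfl

/-- Two strands of `braidHomotopy` would collide if both equations held, with `c + s i` the phase of
a letter. In the main case the real equation forces `u ≤ 1/2`, and then the imaginary part is
strictly negative because `g > 0`. -/
theorem braid_separation {u c s g : ℝ} (hu : u ∈ I) (hs : 0 ≤ s) (hcs : c ^ 2 + s ^ 2 = 1)
    (hg : 0 ≤ g) (hg0 : g = 0 → u = 0 ∨ u = 1 ∨ c = 1)
    (hre : -(1 - u) * c + u * (-3 / 2 + c / 2) = 0)
    (him : -(1 - u) * s + u * s / 2 - g = 0) : False := by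
  have hc1 : c ≤ 1 := by nlinarith
  have hc2 : -1 ≤ c := by nlinarith
  obtain ⟨hu0, hu1⟩ := hu
  by_cases h1 : c = 1
  · subst h1; linarith
  by_cases h2 : u = 1
  · subst h2; linarith
  by_cases h0 : u = 0
  · subst h0
    have : c = 0 := by linarith
    subst this
    nlinarith
  have hgpos : 0 < g := lt_of_le_of_ne hg fun h => by tauto
  have h3 : (1 - u) * (1 + c) ≥ 0 := mul_nonneg (by linarith) (by linarith)
  have h4 : u * (1 - c) ≥ 0 := mul_nonneg hu0 (by linarith)
  have h5 : u ≤ 1 / 2 := by nlinarith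
  nlinarith

/-- The straight-line homotopy between the two sides of the braid relation, with the strands
starting at `-1` and `1` moved apart vertically. -/
noncomputable def braidHomotopy (u t : ℝ) (k : Fin 3) : ℂ :=
  (1 - u) • strand [(0, true), (1, true), (0, true)] (3 * t) k +
    u • strand [(1, true), (0, true), (1, true)] (3 * t) k +
    (u * (1 - u) * (t * (1 - t))) • (![-Complex.I, 0, Complex.I] : Fin 3 → ℂ) k

/-- Without the vertical term, strands 0 and 1 would collide at `t = 1/3`, `u = 1/3`. In the outer
thirds adjacent labels are handled by `braid_separation`, up to the symmetries `u ↦ 1 - u` and `c ↦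
-c`. -/
theorem injective_braidHomotopy {u t : ℝ} (hu : u ∈ I) (ht : t ∈ I) :
    Function.Injective (braidHomotopy u t) := by
  have hu' : 1 - u ∈ I := ⟨by linarith [hu.2], by linarith [hu.1]⟩
  obtain ⟨g, hg⟩ : ∃ g, g = u * (1 - u) * (t * (1 - t)) := ⟨_, rfl⟩
  have hg0 : 0 ≤ g := by
    rw [hg]
    exact mul_nonneg (mul_nonneg hu.1 hu'.1) (mul_nonneg ht.1 (by linarith [ht.2]))
  have hgz : g = 0 → u = 0 ∨ u = 1 ∨ t = 0 ∨ t = 1 := by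
    intro h
    rw [hg] at h
    rcases mul_eq_zero.1 h with h | h <;> rcases mul_eq_zero.1 h with h | h
    · exact Or.inl h
    · exact Or.inr (Or.inl (by linarith))
    · exact Or.inr (Or.inr (Or.inl h))
    · exact Or.inr (Or.inr (Or.inr (by linarith)))
  have phase : ∀ s : ℝ, ∃ c d : ℝ, letterPhase true s = ⟨c, d⟩ ∧ c ^ 2 + d ^ 2 = 1 ∧ 0 ≤ d := by
    intro s
    refine ⟨(letterPhase true s).re, (letterPhase true s).im, rfl, ?_, ?_⟩
    · rw [letterPhase_re, letterPhase_im]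
      simp
    · rw [letterPhase_im, if_pos rfl, one_mul]
      refine Real.sin_nonneg_of_nonneg_of_le_pi
        (mul_nonneg Real.pi_pos.le (Real.smoothTransition.nonneg _)) ?_
      exact mul_le_of_le_one_right Real.pi_pos.le (Real.smoothTransition.le_one _)
  rcases le_total (3 * t) 1 with h1 | h1
  · obtain ⟨c, d, hcd, hsq, hd⟩ := phase (3 * t)
    have hc0 : g = 0 → u = 0 ∨ u = 1 ∨ c = 1 := by
      intro h
      rcases hgz h with h | h | h | h
      · exact Or.inl h
      · exact Or.inr (Or.inl h)
      · subst h
        rw [letterPhase_of_nonpos _ (by norm_num)] at hcd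
        exact Or.inr (Or.inr (congrArg Complex.re hcd).symm)
      · linarith
    have hval : braidHomotopy u t = fun k =>
        (1 - u) • (![-1 / 2 - 1 / 2 * ⟨c, d⟩, -1 / 2 + 1 / 2 * ⟨c, d⟩, 1] : Fin 3 → ℂ) k +
        u • (![-1, 1 / 2 - 1 / 2 * ⟨c, d⟩, 1 / 2 + 1 / 2 * ⟨c, d⟩] : Fin 3 → ℂ) k +
        g • (![-Complex.I, 0, Complex.I] : Fin 3 → ℂ) k := by
      funext k
      rw [braidHomotopy, strand_cons_of_le _ _ h1, strand_cons_of_le _ _ h1, letterStrand,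
        letterStrand, hcd, hg]
      rfl
    rw [hval]
    refine injective_of_ne (fun h => ?_) (fun h => ?_) (fun h => ?_) <;>
      (have hr := congrArg Complex.re h; have hi := congrArg Complex.im h; clear h;
       simp at hr hi)
    · exact braid_separation hu hd hsq hg0 hc0 (by linarith) (by linarith)
    · nlinarith
    · exact braid_separation hu' hd hsq hg0 (fun h => by
        rcases hc0 h with h | h | h
        · right; left; linarith
        · left; linarith
        · right; right; exact h) (by linarith) (by linarith)
  rcases le_total (3 * t - 1) 1 with h2 | h2
  · obtain ⟨c, d, hcd, hsq, hd⟩ := phase (3 * t - 1)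
    have hval : braidHomotopy u t = fun k =>
        (1 - u) • (![1 / 2 - 1 / 2 * ⟨c, d⟩, -1, 1 / 2 + 1 / 2 * ⟨c, d⟩] : Fin 3 → ℂ) k +
        u • (![-1 / 2 - 1 / 2 * ⟨c, d⟩, 1, -1 / 2 + 1 / 2 * ⟨c, d⟩] : Fin 3 → ℂ) k +
        g • (![-Complex.I, 0, Complex.I] : Fin 3 → ℂ) k := by
      funext k
      rw [braidHomotopy, strand_cons_of_ge _ _ h1, strand_cons_of_ge _ _ h1,
        strand_cons_of_le _ _ h2, strand_cons_of_le _ _ h2, letterStrand,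
        letterStrand, hcd, hg]
      fin_cases k <;> simp [artinSwap_apply]
    -- In the middle third `d` and `g` enter each imaginary difference with the same sign, so a
    -- collision makes both vanish. As `t` is away from 0 and 1, this leaves only the ends of the
    -- homotopy.
    have hend : d = 0 → g = 0 → (u = 0 ∨ u = 1) ∧ (c ≤ 1 ∧ -1 ≤ c) := by
      intro h h'
      subst h
      refine ⟨?_, by nlinarith, by nlinarith⟩
      rcases hgz h' with h | h | h | h
      · exact Or.inl h
      · exact Or.inr h
      · linarith
      · linarith
    rw [hval]
    refine injective_of_ne (fun h => ?_) (fun h => ?_) (fun h => ?_) <;>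
      (have hr := congrArg Complex.re h; have hi := congrArg Complex.im h; clear h hval hcd;
       simp at hr hi)
    · have hd0 : d = 0 := by linarith
      obtain ⟨rfl | rfl, h3, h4⟩ := hend hd0 (by linarith) <;> linarith
    · have hd0 : d = 0 := by linarith
      have hc0 : c = 0 := by linarith
      subst hd0 hc0
      norm_num at hsq
    · have hd0 : d = 0 := by linarith
      obtain ⟨rfl | rfl, h3, h4⟩ := hend hd0 (by linarith) <;> linarith
  · obtain ⟨c, d, hcd, hsq, hd⟩ := phase (3 * t - 1 - 1)
    have hc0 : g = 0 → u = 0 ∨ u = 1 ∨ -c = 1 := by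
      intro h
      rcases hgz h with h | h | h | h
      · exact Or.inl h
      · exact Or.inr (Or.inl h)
      · linarith
      · subst h
        rw [letterPhase_of_one_le _ (by norm_num)] at hcd
        have := congrArg Complex.re hcd
        simp at this
        exact Or.inr (Or.inr (by linarith))
    have hval : braidHomotopy u t = fun k =>
        (1 - u) • (![1, -1 / 2 - 1 / 2 * ⟨c, d⟩, -1 / 2 + 1 / 2 * ⟨c, d⟩] : Fin 3 → ℂ) k +
        u • (![1 / 2 - 1 / 2 * ⟨c, d⟩, 1 / 2 + 1 / 2 * ⟨c, d⟩, -1] : Fin 3 → ℂ) k +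
        g • (![-Complex.I, 0, Complex.I] : Fin 3 → ℂ) k := by
      funext k
      rw [braidHomotopy, strand_cons_of_ge _ _ h1, strand_cons_of_ge _ _ h1,
        strand_cons_of_ge _ _ h2, strand_cons_of_ge _ _ h2,
        strand_cons_of_le _ _ (by linarith [ht.2]), strand_cons_of_le _ _ (by linarith [ht.2]),
        letterStrand, letterStrand, hcd, hg]
      fin_cases k <;> simp [artinSwap_apply]
    have hsq' : (-c) ^ 2 + d ^ 2 = 1 := by linarith [neg_sq c]
    rw [hval]
    refine injective_of_ne (fun h => ?_) (fun h => ?_) (fun h => ?_) <;>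
      (have hr := congrArg Complex.re h; have hi := congrArg Complex.im h; clear h hval hcd;
       simp at hr hi)
    · exact braid_separation hu' hd hsq' hg0 (fun h => by
        rcases hc0 h with h | h | h
        · right; left; linarith
        · left; linarith
        · right; right; exact h) (by linarith) (by linarith)
    · nlinarith
    · exact braid_separation hu hd hsq' hg0 hc0 (by linarith) (by linarith)

theorem abs_re_braidHomotopy_le {u : ℝ} (hu : u ∈ I) (t : ℝ) (k : Fin 3) :
    |(braidHomotopy u t k).re| ≤ 1 := by
  have h1 := abs_le.1 (abs_re_strand_le [(0, true), (1, true), (0, true)] (3 * t) k)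
  have h2 := abs_le.1 (abs_re_strand_le [(1, true), (0, true), (1, true)] (3 * t) k)
  have h3 : ((![-Complex.I, 0, Complex.I] : Fin 3 → ℂ) k).re = 0 := by fin_cases k <;> simp
  have e : (braidHomotopy u t k).re =
      (1 - u) * (strand [(0, true), (1, true), (0, true)] (3 * t) k).re +
      u * (strand [(1, true), (0, true), (1, true)] (3 * t) k).re := by
    simp [braidHomotopy, h3, -Complex.real_smul, Complex.smul_re]
  rw [e, abs_le]
  obtain ⟨hu0, hu1⟩ := hu
  constructor <;> nlinarith

/-- The braid relation for loops of configurations. -/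
theorem wordLoop_braid : (wordLoop [(0, true), (1, true), (0, true)] 3 (by norm_num)).Homotopic
    (wordLoop [(1, true), (0, true), (1, true)] 3 (by norm_num)) := by
  let F : I × I → Conf := fun q => ⟨braidHomotopy q.1 q.2, injective_braidHomotopy q.1.2 q.2.2,
    fun k => by linarith [(abs_le.1 (abs_re_braidHomotopy_le q.1.2 q.2 k)).1]⟩
  have hF : Continuous F := by
    refine continuous_induced_rng.2 (continuous_pi fun k => ?_)
    have h1 := continuous_strand [(0, true), (1, true), (0, true)] k
    have h2 := continuous_strand [(1, true), (0, true), (1, true)] k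
    change Continuous fun q : I × I => braidHomotopy q.1 q.2 k
    unfold braidHomotopy
    fun_prop
  have hperm : ∀ k, strand [(0, true), (1, true), (0, true)] 3 k =
      strand [(1, true), (0, true), (1, true)] 3 k := by
    intro k
    rw [strand_of_length_le _ (by norm_num), strand_of_length_le _ (by norm_num)]
    congr 4
    simpa [mul_assoc] using artin_braid
  refine ⟨⟨⟨⟨fun q => UConf.mk (F q), UConf.continuous_mk.comp hF⟩, fun t => ?_, fun t => ?_⟩,
    fun u t ht => ?_⟩⟩
  · refine mk_eq_of_comp 1 fun k => ?_
    simp [F, braidHomotopy, strandConf]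
  · refine mk_eq_of_comp 1 fun k => ?_
    simp [F, braidHomotopy, strandConf]
  · refine mk_eq_of_comp 1 fun k => ?_
    rcases ht with rfl | rfl
    · simp [F, braidHomotopy, strandConf, strand_of_nonpos]
      ring
    · simp [F, braidHomotopy, strandConf, hperm]
      ring

/-- The homomorphism from the braid group to the opposite of the fundamental group (whose product
composes from right to left). -/
noncomputable def braidHom : B3 →* (FundamentalGroup UConf baseConf)ᵐᵒᵖ :=
  PresentedGroup.toGroup
    (f := fun i => MulOpposite.op (loopClass (wordLoop [(i, true)] 1 (by simp)))) (by
    rintro r rfl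
    simp only [map_mul, map_inv, FreeGroup.lift_apply_of, mul_inv_eq_one]
    have key : ∀ i j k : Fin 2, loopClass (wordLoop [(i, true), (j, true), (k, true)] 3
        (by norm_num)) = loopClass (wordLoop [(k, true)] 1 (by simp)) *
        loopClass (wordLoop [(j, true)] 1 (by simp)) *
        loopClass (wordLoop [(i, true)] 1 (by simp)) := by
      intro i j k
      have h1 := loopClass_wordLoop_cons (i, true) [(j, true), (k, true)] 2 (by norm_num)
      have h2 := loopClass_wordLoop_cons (j, true) [(k, true)] 1 (by norm_num)
      norm_num at h1 h2
      rw [h1, h2]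
      rfl
    have h := loopClass_eq.2 wordLoop_braid
    rw [key, key] at h
    simpa only [← MulOpposite.op_mul, mul_assoc] using congrArg MulOpposite.op h)

/-- The left side does not involve `c`, so the speed and the resting time at the end do not affect
the class. -/
theorem braidHom_evalWord (w : Word (Fin 2)) (c : ℝ) (hc : w.length ≤ c) :
    braidHom (evalWord artin w) = MulOpposite.op (loopClass (wordLoop w c hc)) := by
  induction w generalizing c with
  | nil => rw [loopClass_wordLoop_nil, evalWord_nil, map_one, MulOpposite.op_one]
  | cons x w ih =>
    obtain ⟨c, rfl⟩ : ∃ c', c = c' + 1 := ⟨c - 1, by ring⟩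
    have hc' : (w.length : ℝ) ≤ c := by simpa using hc
    rw [loopClass_wordLoop_cons x w c hc', MulOpposite.op_mul, evalWord_cons, map_mul, ih c hc']
    congr 1
    obtain ⟨i, _ | _⟩ := x
    · rw [wordLoop_inverse, loopClass_symm]
      simp only [Bool.false_eq_true, if_false, map_inv, MulOpposite.op_inv]
      congr 1
      exact PresentedGroup.toGroup.of _
    · exact PresentedGroup.toGroup.of _

/-- Words that represent conjugate braids have ambient isotopic closures. -/
theorem ambientIsotopic_closedBraid {w w' : Word (Fin 2)}
    (h : IsConj (evalWord artin w) (evalWord artin w')) :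
    AmbientIsotopic (closedBraid w) (closedBraid w') := by
  rw [closedBraid_eq_loopClosure, closedBraid_eq_loopClosure]
  apply ambientIsotopic_of_isConj
  obtain ⟨c, hc⟩ := isConj_iff.1 h
  have := congrArg braidHom hc
  rw [map_mul, map_mul, map_inv, braidHom_evalWord w _ (by linarith : _ ≤ (w.length : ℝ) + 1),
    braidHom_evalWord w' _ (by linarith : _ ≤ (w'.length : ℝ) + 1)] at this
  refine isConj_iff.2 ⟨(braidHom c).unop⁻¹, ?_⟩
  have := congrArg MulOpposite.unop this
  simpa only [MulOpposite.unop_mul, MulOpposite.unop_inv, MulOpposite.unop_op, inv_inv,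
    mul_assoc] using this

/-! ### Closures of two-letter words -/

/-- The sign of an exponent. -/
def boolSign (e : Bool) : ℝ := if e then 1 else -1

/-- The coefficient of the closed plane curve on which three points chase each other. -/
noncomputable def chaseCoeff (e f : Bool) (y : ℝ) : ℝ :=
  (boolSign e + boolSign f) / 2 + (boolSign f - boolSign e) * y

/-- A closed plane curve: a circle if the two signs agree, a figure eight otherwise. -/
noncomputable def chaseCurve (e f : Bool) (a : ℝ) : ℂ :=
  ⟨Real.sin a, -(chaseCoeff e f (Real.sin a) * Real.cos a)⟩

/-- The initial positions of the three points on the curve. -/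
noncomputable def chaseOffset : Fin 3 → ℝ := ![-(Real.pi / 3), Real.pi, Real.pi / 3]

/-- Three points chasing each other for a third of the period. -/
noncomputable def chase (e f : Bool) (t : ℝ) (k : Fin 3) : ℂ :=
  chaseCurve e f (2 * Real.pi * t / 3 + chaseOffset k)

theorem abs_chaseCoeff_mul_le (e f : Bool) (a : ℝ) :
    |chaseCoeff e f (Real.sin a) * Real.cos a| ≤ 1 := by
  have h1 := Real.sin_sq_add_cos_sq a
  rw [abs_le]
  cases e <;> cases f <;> norm_num [chaseCoeff, boolSign] <;> constructor <;>
    nlinarith [sq_nonneg (Real.sin a + Real.cos a), sq_nonneg (Real.sin a - Real.cos a),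
      sq_nonneg (Real.sin a)]

/-- A bound on the norm, not just on the real part, keeps the chase in the half-plane under every
rotation. -/
theorem norm_chaseCurve_lt (e f : Bool) (a : ℝ) : ‖chaseCurve e f a‖ < 2 := by
  have h1 := abs_chaseCoeff_mul_le e f a
  have h2 := (sq_le_one_iff_abs_le_one _).2 h1
  have h3 := Real.sin_sq_le_one a
  rw [Complex.norm_def, Complex.normSq_apply, Real.sqrt_lt' two_pos]
  simp only [chaseCurve]
  nlinarith

theorem continuous_chaseCurve (e f : Bool) : Continuous (chaseCurve e f) := by
  have : chaseCurve e f = fun a => ((Real.sin a : ℝ) : ℂ) +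
      ((-(chaseCoeff e f (Real.sin a) * Real.cos a) : ℝ) : ℂ) * Complex.I := by
    funext a
    apply Complex.ext <;> simp [chaseCurve, -Complex.ofReal_sin, -Complex.ofReal_cos]
  rw [this]
  unfold chaseCoeff
  fun_prop

theorem continuous_chase (e f : Bool) (k : Fin 3) : Continuous fun t => chase e f t k :=
  (continuous_chaseCurve e f).comp (by fun_prop)

theorem chaseCurve_add_two_pi (e f : Bool) (a : ℝ) :
    chaseCurve e f (a + 2 * Real.pi) = chaseCurve e f a := by
  simp [chaseCurve]

/-- The cyclic permutation of the strands. -/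
def chasePerm : Equiv.Perm (Fin 3) := artinSwap 1 * artinSwap 0

theorem chase_one (e f : Bool) (k : Fin 3) : chase e f 1 k = chase e f 0 (chasePerm k) := by
  have h : ∀ k, chasePerm k = ![2, 0, 1] k := by decide
  rw [h]
  fin_cases k <;> simp [chase, chaseOffset]
  · congr 1; ring
  · rw [← chaseCurve_add_two_pi e f (-(Real.pi / 3))]; congr 1; ring
  · congr 1; ring

theorem strand_two (e f : Bool) (k : Fin 3) :
    strand [(0, e), (1, f)] 2 k = strand [(0, e), (1, f)] 0 (chasePerm k) := by
  rw [strand_cons_of_ge _ _ (by norm_num), strand_cons_of_ge _ _ (by norm_num), strand,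
    strand_of_nonpos _ le_rfl]
  rfl

theorem smoothTransition_half : Real.smoothTransition (1 / 2) = 1 / 2 := by
  have := smoothTransition_one_sub (1 / 2)
  norm_num at this
  norm_num
  linarith

theorem letterPhase_half (e : Bool) : letterPhase e (1 / 2) = ⟨0, boolSign e⟩ := by
  apply Complex.ext
  · rw [letterPhase_re, smoothTransition_half, mul_one_div, Real.cos_pi_div_two]
  · rw [letterPhase_im, smoothTransition_half, mul_one_div, Real.sin_pi_div_two]
    simp [boolSign]

theorem letterPhase_re_nonneg (e : Bool) {s : ℝ} (h : s ≤ 1 / 2) : 0 ≤ (letterPhase e s).re := by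
  have h1 := Real.smoothTransition.monotone h
  rw [smoothTransition_half] at h1
  have h2 := Real.smoothTransition.nonneg s
  rw [letterPhase_re]
  have := Real.pi_pos
  exact Real.cos_nonneg_of_neg_pi_div_two_le_of_le (by nlinarith) (by nlinarith)

theorem letterPhase_re_nonpos (e : Bool) {s : ℝ} (h : 1 / 2 ≤ s) : (letterPhase e s).re ≤ 0 := by
  have h1 := Real.smoothTransition.monotone h
  rw [smoothTransition_half] at h1
  have h2 := Real.smoothTransition.le_one s
  rw [letterPhase_re]
  have := Real.pi_pos
  exact Real.cos_nonpos_of_pi_div_two_le_of_le (by nlinarith) (by nlinarith)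

theorem strand_two_letters_of_le (e f : Bool) {t : ℝ} (ht : t ≤ 1 / 2) :
    strand [(0, e), (1, f)] (2 * t) =
      ![-1 / 2 - 1 / 2 * letterPhase e (2 * t), -1 / 2 + 1 / 2 * letterPhase e (2 * t), 1] := by
  rw [strand_cons_of_le _ _ (by linarith)]
  rfl

theorem strand_two_letters_of_ge (e f : Bool) {t : ℝ} (ht : 1 / 2 ≤ t) (ht1 : t ≤ 1) :
    strand [(0, e), (1, f)] (2 * t) = ![1 / 2 - 1 / 2 * letterPhase f (2 * t - 1), -1,
      1 / 2 + 1 / 2 * letterPhase f (2 * t - 1)] := by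
  funext k
  rw [strand_cons_of_ge _ _ (by linarith), strand_cons_of_le _ _ (by linarith), letterStrand]
  fin_cases k <;> simp [artinSwap_apply]

/-! ### Crossings of the chase and comparison with the two letters. -/

theorem sin_sub_sin_zero_one (ψ : ℝ) : Real.sin (ψ + -(Real.pi / 3)) - Real.sin (ψ + Real.pi) =
    √3 * Real.sin (ψ - Real.pi / 6) := by
  have h3 : √3 * √3 = 3 := Real.mul_self_sqrt (by norm_num)
  rw [← sub_eq_add_neg, Real.sin_sub, Real.sin_sub, Real.sin_add_pi, Real.sin_pi_div_three,
    Real.cos_pi_div_three, Real.sin_pi_div_six, Real.cos_pi_div_six]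
  linear_combination -Real.sin ψ / 2 * h3

theorem sin_sub_sin_zero_two (ψ : ℝ) :
    Real.sin (ψ + -(Real.pi / 3)) - Real.sin (ψ + Real.pi / 3) = -(√3 * Real.cos ψ) := by
  rw [← sub_eq_add_neg, Real.sin_sub, Real.sin_add, Real.sin_pi_div_three]
  ring

theorem sin_sub_sin_one_two (ψ : ℝ) : Real.sin (ψ + Real.pi) - Real.sin (ψ + Real.pi / 3) =
    -(√3 * Real.sin (ψ + Real.pi / 6)) := by
  have h3 : √3 * √3 = 3 := Real.mul_self_sqrt (by norm_num)
  rw [Real.sin_add_pi, Real.sin_add, Real.sin_add, Real.sin_pi_div_three,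
    Real.cos_pi_div_three, Real.sin_pi_div_six, Real.cos_pi_div_six]
  linear_combination Real.sin ψ / 2 * h3

/-- The phase `2πt/3` reaches the zero `π/6` of the difference exactly at `t = 1/4`, the middle of
the first letter. Likewise strands 0 and 2 cross at `t = 3/4`, while strands 1 and 2 never do. -/
theorem chase_re_lt_zero_one (e f : Bool) {t : ℝ} (h0 : 0 ≤ t) (h : t < 1 / 4) :
    (chase e f t 0).re < (chase e f t 1).re := by
  have hp := Real.pi_pos
  have := sin_sub_sin_zero_one (2 * Real.pi * t / 3)
  have h2 := Real.sin_neg_of_neg_of_neg_pi_lt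
    (x := 2 * Real.pi * t / 3 - Real.pi / 6) (by nlinarith) (by nlinarith)
  have h3 : 0 < √3 := by positivity
  change Real.sin (_ + -(Real.pi / 3)) < Real.sin (_ + Real.pi)
  nlinarith

theorem chase_re_gt_zero_one (e f : Bool) {t : ℝ} (h : 1 / 4 < t) (h1 : t ≤ 1) :
    (chase e f t 1).re < (chase e f t 0).re := by
  have hp := Real.pi_pos
  have := sin_sub_sin_zero_one (2 * Real.pi * t / 3)
  have h2 := Real.sin_pos_of_pos_of_lt_pi
    (x := 2 * Real.pi * t / 3 - Real.pi / 6) (by nlinarith) (by nlinarith)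
  have h3 : 0 < √3 := by positivity
  change Real.sin (_ + Real.pi) < Real.sin (_ + -(Real.pi / 3))
  nlinarith

theorem chase_re_lt_zero_two (e f : Bool) {t : ℝ} (h0 : 0 ≤ t) (h : t < 3 / 4) :
    (chase e f t 0).re < (chase e f t 2).re := by
  have hp := Real.pi_pos
  have := sin_sub_sin_zero_two (2 * Real.pi * t / 3)
  have h2 := Real.cos_pos_of_mem_Ioo (x := 2 * Real.pi * t / 3) ⟨by nlinarith, by nlinarith⟩
  have h3 : 0 < √3 := by positivity
  change Real.sin (_ + -(Real.pi / 3)) < Real.sin (_ + Real.pi / 3)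
  nlinarith

theorem chase_re_gt_zero_two (e f : Bool) {t : ℝ} (h : 3 / 4 < t) (h1 : t ≤ 1) :
    (chase e f t 2).re < (chase e f t 0).re := by
  have hp := Real.pi_pos
  have := sin_sub_sin_zero_two (2 * Real.pi * t / 3)
  have h2 := Real.cos_neg_of_pi_div_two_lt_of_lt (x := 2 * Real.pi * t / 3)
    (by nlinarith) (by nlinarith)
  have h3 : 0 < √3 := by positivity
  change Real.sin (_ + Real.pi / 3) < Real.sin (_ + -(Real.pi / 3))
  nlinarith

theorem chase_re_lt_one_two (e f : Bool) {t : ℝ} (h0 : 0 ≤ t) (h1 : t ≤ 1) :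
    (chase e f t 1).re < (chase e f t 2).re := by
  have hp := Real.pi_pos
  have := sin_sub_sin_one_two (2 * Real.pi * t / 3)
  have h2 := Real.sin_pos_of_pos_of_lt_pi
    (x := 2 * Real.pi * t / 3 + Real.pi / 6) (by positivity) (by nlinarith)
  have h3 : 0 < √3 := by positivity
  change Real.sin (_ + Real.pi) < Real.sin (_ + Real.pi / 3)
  nlinarith

/-- Here both points have real part `-1/2`, where `chaseCoeff` takes the sign of `e`; at the second
crossing the real part is `1/2` and the sign is that of `f`. This is what makes the crossings agree
with the letters. -/
theorem chase_im_zero_one (e f : Bool) :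
    (chase e f (1 / 4) 0).im - (chase e f (1 / 4) 1).im = -√3 * boolSign e := by
  have e0 : 2 * Real.pi * (1 / 4) / 3 + chaseOffset 0 = -(Real.pi / 6) := by
    simp [chaseOffset]; ring
  have e1 : 2 * Real.pi * (1 / 4) / 3 + chaseOffset 1 = Real.pi / 6 + Real.pi := by
    simp [chaseOffset]; ring
  simp only [chase, e0, e1, chaseCurve, chaseCoeff, Real.sin_neg, Real.cos_neg, Real.sin_add_pi,
    Real.cos_add_pi, Real.sin_pi_div_six, Real.cos_pi_div_six]
  ring

theorem chase_im_zero_two (e f : Bool) :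
    (chase e f (3 / 4) 0).im - (chase e f (3 / 4) 2).im = -√3 * boolSign f := by
  have e0 : 2 * Real.pi * (3 / 4) / 3 + chaseOffset 0 = Real.pi / 6 := by
    simp [chaseOffset]; ring
  have e1 : 2 * Real.pi * (3 / 4) / 3 + chaseOffset 2 = Real.pi - Real.pi / 6 := by
    simp [chaseOffset]; ring
  simp only [chase, e0, e1, chaseCurve, chaseCoeff, Real.sin_pi_sub, Real.cos_pi_sub,
    Real.sin_pi_div_six, Real.cos_pi_div_six]
  ring

theorem injective_chase (e f : Bool) {t : ℝ} (ht : t ∈ I) : Function.Injective (chase e f t) := by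
  have h3 : 0 < √3 := by positivity
  have hs : ∀ e, boolSign e ≠ 0 := by intro e; cases e <;> norm_num [boolSign]
  refine injective_of_ne (fun h => ?_) (fun h => ?_) (fun h => ?_)
  · rcases lt_trichotomy t (1 / 4) with h1 | rfl | h1
    · exact absurd (congrArg Complex.re h) (chase_re_lt_zero_one e f ht.1 h1).ne
    · have := chase_im_zero_one e f
      rw [h, sub_self] at this
      exact mul_ne_zero (neg_ne_zero.2 h3.ne') (hs e) this.symm
    · exact absurd (congrArg Complex.re h) (chase_re_gt_zero_one e f h1 ht.2).ne'
  · rcases lt_trichotomy t (3 / 4) with h1 | rfl | h1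
    · exact absurd (congrArg Complex.re h) (chase_re_lt_zero_two e f ht.1 h1).ne
    · have := chase_im_zero_two e f
      rw [h, sub_self] at this
      exact mul_ne_zero (neg_ne_zero.2 h3.ne') (hs f) this.symm
    · exact absurd (congrArg Complex.re h) (chase_re_gt_zero_two e f h1 ht.2).ne'
  · exact absurd (congrArg Complex.re h) (chase_re_lt_one_two e f ht.1 ht.2).ne

theorem strand_re_zero_one (e f : Bool) {t : ℝ} (ht : t ∈ I) :
    (t ≤ 1 / 4 → (strand [(0, e), (1, f)] (2 * t) 0).re ≤
      (strand [(0, e), (1, f)] (2 * t) 1).re) ∧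
    (1 / 4 ≤ t → (strand [(0, e), (1, f)] (2 * t) 1).re ≤
      (strand [(0, e), (1, f)] (2 * t) 0).re) := by
  rcases le_total t (1 / 2) with h | h
  · rw [strand_two_letters_of_le e f h]
    simp
    constructor
    · intro h1
      have := letterPhase_re_nonneg e (s := 2 * t) (by linarith)
      linarith
    · intro h1
      have := letterPhase_re_nonpos e (s := 2 * t) (by linarith)
      linarith
  · rw [strand_two_letters_of_ge e f h ht.2]
    simp
    have := (Complex.re_le_norm (letterPhase f (2 * t - 1))).trans (norm_letterPhase f _).le
    constructor <;> intro h1 <;> linarith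

theorem strand_re_zero_two (e f : Bool) {t : ℝ} (ht : t ∈ I) :
    (t ≤ 3 / 4 → (strand [(0, e), (1, f)] (2 * t) 0).re ≤
      (strand [(0, e), (1, f)] (2 * t) 2).re) ∧
    (3 / 4 ≤ t → (strand [(0, e), (1, f)] (2 * t) 2).re ≤
      (strand [(0, e), (1, f)] (2 * t) 0).re) := by
  rcases le_total t (1 / 2) with h | h
  · rw [strand_two_letters_of_le e f h]
    simp
    have := (abs_le.1 ((Complex.abs_re_le_norm (letterPhase e (2 * t))).trans
      (norm_letterPhase e _).le)).1
    constructor <;> intro h1 <;> linarith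
  · rw [strand_two_letters_of_ge e f h ht.2]
    simp
    constructor
    · intro h1
      have := letterPhase_re_nonneg f (s := 2 * t - 1) (by linarith)
      linarith
    · intro h1
      have := letterPhase_re_nonpos f (s := 2 * t - 1) (by linarith)
      linarith

theorem strand_re_one_two (e f : Bool) {t : ℝ} (ht : t ∈ I) :
    (strand [(0, e), (1, f)] (2 * t) 1).re ≤ (strand [(0, e), (1, f)] (2 * t) 2).re := by
  rcases le_total t (1 / 2) with h | h
  · rw [strand_two_letters_of_le e f h]
    simp
    have := (Complex.re_le_norm (letterPhase e (2 * t))).trans (norm_letterPhase e _).le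
    linarith
  · rw [strand_two_letters_of_ge e f h ht.2]
    simp
    have := (abs_le.1 ((Complex.abs_re_le_norm (letterPhase f (2 * t - 1))).trans
      (norm_letterPhase f _).le)).1
    linarith

theorem strand_im_zero_one (e f : Bool) : (strand [(0, e), (1, f)] (2 * (1 / 4)) 0).im -
    (strand [(0, e), (1, f)] (2 * (1 / 4)) 1).im = -boolSign e := by
  rw [strand_two_letters_of_le e f (by norm_num), show (2 * (1 / 4) : ℝ) = 1 / 2 by norm_num,
    letterPhase_half]
  simp
  ring

theorem strand_im_zero_two (e f : Bool) : (strand [(0, e), (1, f)] (2 * (3 / 4)) 0).im -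
    (strand [(0, e), (1, f)] (2 * (3 / 4)) 2).im = -boolSign f := by
  rw [strand_two_letters_of_ge e f (by norm_num) (by norm_num),
    show (2 * (3 / 4) - 1 : ℝ) = 1 / 2 by norm_num, letterPhase_half]
  simp
  ring

/-- The straight-line homotopy from the strands of a two-letter word to the chase. -/
noncomputable def chaseHomotopy (e f : Bool) (u t : ℝ) (k : Fin 3) : ℂ :=
  (1 - u) • strand [(0, e), (1, f)] (2 * t) k + u • chase e f t k

/-- For each pair of strands both motions have the same order of real parts at every time, and at
the crossing times imaginary differences of the same sign. Convex combinations therefore stay apart.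
-/
theorem injective_chaseHomotopy (e f : Bool) {u t : ℝ} (hu : u ∈ I) (ht : t ∈ I) :
    Function.Injective (chaseHomotopy e f u t) := by
  have h3 : 0 < √3 := by positivity
  have hs : ∀ e, boolSign e ≠ 0 := by intro e; cases e <;> norm_num [boolSign]
  obtain ⟨hu0, hu1⟩ := hu
  -- The inequalities for the word are weak and those for the chase strict, so the latter must have
  -- positive weight.
  rcases hu0.eq_or_lt with rfl | hu0
  · convert injective_strand [(0, e), (1, f)] (2 * t) using 1
    funext k
    simp [chaseHomotopy]
  have hre : ∀ i j, chaseHomotopy e f u t i = chaseHomotopy e f u t j →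
      (1 - u) * ((strand [(0, e), (1, f)] (2 * t) i).re - (strand [(0, e), (1, f)] (2 * t) j).re) +
        u * ((chase e f t i).re - (chase e f t j).re) = 0 := by
    intro i j h
    have := congrArg Complex.re h
    simp only [chaseHomotopy, Complex.add_re, Complex.smul_re, smul_eq_mul] at this
    linear_combination this
  have him : ∀ i j, chaseHomotopy e f u t i = chaseHomotopy e f u t j →
      (1 - u) * ((strand [(0, e), (1, f)] (2 * t) i).im - (strand [(0, e), (1, f)] (2 * t) j).im) +
        u * ((chase e f t i).im - (chase e f t j).im) = 0 := by
    intro i j h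
    have := congrArg Complex.im h
    simp only [chaseHomotopy, Complex.add_im, Complex.smul_im, smul_eq_mul] at this
    linear_combination this
  have hsep : ∀ b : Bool, (1 - u) * -boolSign b + u * (-√3 * boolSign b) ≠ 0 := by
    intro b h
    have : (1 - u + u * √3) * boolSign b = 0 := by linear_combination -h
    rcases mul_eq_zero.1 this with h | h
    · have := mul_pos hu0 h3
      linarith
    · exact hs b h
  have hneg : ∀ a d : ℝ, a ≤ 0 → d < 0 → (1 - u) * a + u * d ≠ 0 := by
    intro a d ha hd h
    have h1 := mul_nonneg (sub_nonneg.2 hu1) (neg_nonneg.2 ha)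
    have h2 := mul_pos hu0 (neg_pos.2 hd)
    linarith
  have hpos : ∀ a d : ℝ, 0 ≤ a → 0 < d → (1 - u) * a + u * d ≠ 0 := by
    intro a d ha hd h
    have h1 := mul_nonneg (sub_nonneg.2 hu1) ha
    have h2 := mul_pos hu0 hd
    linarith
  refine injective_of_ne (fun h => ?_) (fun h => ?_) (fun h => ?_)
  · obtain ⟨hl, hg⟩ := strand_re_zero_one e f ht
    rcases lt_trichotomy t (1 / 4) with h1 | rfl | h1
    · exact hneg _ _ (sub_nonpos.2 (hl h1.le)) (sub_neg.2 (chase_re_lt_zero_one e f ht.1 h1))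
        (hre _ _ h)
    · have := him _ _ h
      rw [chase_im_zero_one, strand_im_zero_one] at this
      exact hsep e this
    · exact hpos _ _ (sub_nonneg.2 (hg h1.le)) (sub_pos.2 (chase_re_gt_zero_one e f h1 ht.2))
        (hre _ _ h)
  · obtain ⟨hl, hg⟩ := strand_re_zero_two e f ht
    rcases lt_trichotomy t (3 / 4) with h1 | rfl | h1
    · exact hneg _ _ (sub_nonpos.2 (hl h1.le)) (sub_neg.2 (chase_re_lt_zero_two e f ht.1 h1))
        (hre _ _ h)
    · have := him _ _ h
      rw [chase_im_zero_two, strand_im_zero_two] at this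
      exact hsep f this
    · exact hpos _ _ (sub_nonneg.2 (hg h1.le)) (sub_pos.2 (chase_re_gt_zero_two e f h1 ht.2))
        (hre _ _ h)
  · exact hneg _ _ (sub_nonpos.2 (strand_re_one_two e f ht))
      (sub_neg.2 (chase_re_lt_one_two e f ht.1 ht.2)) (hre _ _ h)

theorem neg_two_lt_re_chaseHomotopy (e f : Bool) {u : ℝ} (hu : u ∈ I) (t : ℝ) (k : Fin 3) :
    -2 < (chaseHomotopy e f u t k).re := by
  have h1 := (abs_le.1 (abs_re_strand_le [(0, e), (1, f)] (2 * t) k)).1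
  have h2 := Real.neg_one_le_sin (2 * Real.pi * t / 3 + chaseOffset k)
  have e : (chaseHomotopy e f u t k).re = (1 - u) * (strand [(0, e), (1, f)] (2 * t) k).re +
      u * Real.sin (2 * Real.pi * t / 3 + chaseOffset k) := by
    simp only [chaseHomotopy, Complex.add_re, Complex.smul_re, smul_eq_mul]
    rfl
  rw [e]
  obtain ⟨hu0, hu1⟩ := hu
  nlinarith

/-- The rotated chase as a family of configurations. -/
noncomputable def chaseConf (e f : Bool) (r : ℝ) (t : I) : Conf :=
  ⟨fun k => Complex.exp (r * Complex.I) * chase e f t k,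
    fun _ _ h => injective_chase e f t.2 (mul_left_cancel₀ (Complex.exp_ne_zero _) h), fun k => by
    have h := (abs_le.1 (Complex.abs_re_le_norm (Complex.exp (r * Complex.I) * chase e f t k))).1
    rw [norm_mul, Complex.norm_exp_ofReal_mul_I, one_mul] at h
    have h2 : ‖chase e f t k‖ < 2 := norm_chaseCurve_lt e f _
    linarith⟩

theorem ambientIsotopic_chase_zero (e f : Bool) :
    AmbientIsotopic (closedBraid [(0, e), (1, f)])
      (loopClosure fun t => UConf.mk (chaseConf e f 0 t)) := by
  have h1 : AmbientIsotopic (closedBraid [(0, e), (1, f)])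
      (loopClosure (wordLoop [(0, e), (1, f)] 2 (by norm_num))) := by
    rw [closedBraid_eq_loopClosure]
    -- The closure uses speed 3 and the chase is matched with speed 2; `braidHom` sees no
    -- difference.
    apply ambientIsotopic_of_homotopic
    rw [← loopClass_eq]
    apply MulOpposite.op_injective
    rw [← braidHom_evalWord, ← braidHom_evalWord]
  refine h1.trans ?_
  let F : I × I → Conf := fun q => ⟨chaseHomotopy e f q.1 q.2,
    injective_chaseHomotopy e f q.1.2 q.2.2, neg_two_lt_re_chaseHomotopy e f q.1.2 q.2⟩
  have hF : Continuous F := by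
    refine continuous_induced_rng.2 (continuous_pi fun k => ?_)
    have h1 := continuous_strand [(0, e), (1, f)] k
    have h2 := continuous_chase e f k
    change Continuous fun q : I × I => chaseHomotopy e f q.1 q.2 k
    unfold chaseHomotopy
    fun_prop
  have := ambientIsotopic_of_freeHomotopy (fun q => UConf.mk (F q)) (UConf.continuous_mk.comp hF)
    (fun s => (mk_eq_of_comp chasePerm fun k => by
      simp [F, chaseHomotopy, chase_one, strand_two]).symm)
  convert this using 2
  · funext t
    refine mk_eq_of_comp 1 fun k => ?_
    simp [F, chaseHomotopy, strandConf]
  · funext t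
    refine mk_eq_of_comp 1 fun k => ?_
    simp [F, chaseHomotopy, chaseConf]

theorem ambientIsotopic_chase_rotate (e f : Bool) :
    AmbientIsotopic (loopClosure fun t => UConf.mk (chaseConf e f 0 t))
      (loopClosure fun t => UConf.mk (chaseConf e f (Real.pi / 2) t)) := by
  let F : I × I → Conf := fun q => chaseConf e f (q.1 * (Real.pi / 2)) q.2
  have hF : Continuous F := by
    refine continuous_induced_rng.2 (continuous_pi fun k => ?_)
    have h2 := continuous_chase e f k
    change Continuous fun q : I × I =>
      Complex.exp ((q.1 * (Real.pi / 2) : ℝ) * Complex.I) * chase e f q.2 k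
    fun_prop
  have := ambientIsotopic_of_freeHomotopy (fun q => UConf.mk (F q)) (UConf.continuous_mk.comp hF)
    (fun s => (mk_eq_of_comp chasePerm fun k => by
      simp [F, chaseConf, chase_one]).symm)
  simpa [F] using this

/-! ### The unknot -/

/-- The point of Euclidean space with horizontal part `w` and height `h`. -/
noncomputable def spacePoint (w : ℂ) (h : ℝ) : E3 := !₂[w.re, w.im, h]

/-- The horizontal part of a point of Euclidean space. -/
noncomputable def horizontal (p : E3) : ℂ := ⟨p 0, p 1⟩

@[simp] theorem horizontal_spacePoint (w : ℂ) (h : ℝ) : horizontal (spacePoint w h) = w := by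
  simp [horizontal, spacePoint]

@[simp] theorem spacePoint_two (w : ℂ) (h : ℝ) : spacePoint w h 2 = h := by
  simp [spacePoint]

@[simp] theorem spacePoint_horizontal (p : E3) : spacePoint (horizontal p) (p 2) = p := by
  ext i
  fin_cases i <;> simp [horizontal, spacePoint]

theorem continuous_spacePoint : Continuous fun q : ℂ × ℝ => spacePoint q.1 q.2 := by
  unfold spacePoint
  refine (PiLp.continuous_toLp 2 _).comp (continuous_pi fun i => ?_)
  fin_cases i <;> simp <;> fun_prop

theorem continuous_horizontal : Continuous horizontal := by
  have : horizontal = fun p : E3 => ((p 0 : ℝ) : ℂ) + ((p 1 : ℝ) : ℂ) * Complex.I := by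
    funext p
    apply Complex.ext <;> simp [horizontal]
  rw [this]
  fun_prop

/-- A homeomorphism of Euclidean space that preserves the height and acts on each horizontal plane
by a complex affine map. -/
noncomputable def horizontalAffine (v m : ℝ → ℂ) (hv : Continuous v) (hm : Continuous m)
    (h0 : ∀ y, v y ≠ 0) : E3 ≃ₜ E3 where
  toFun p := spacePoint (v (p 2) * horizontal p + m (p 2)) (p 2)
  invFun p := spacePoint ((v (p 2))⁻¹ * (horizontal p - m (p 2))) (p 2)
  left_inv p := by simp [h0]
  right_inv p := by simp [h0]
  continuous_toFun := by
    have := continuous_horizontal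
    exact continuous_spacePoint.comp (Continuous.prodMk (by fun_prop) (by fun_prop))
  continuous_invFun := by
    have := continuous_horizontal
    have h2 : Continuous fun p : E3 => v (p 2) := by fun_prop
    have h3 := h2.inv₀ fun p => h0 _
    exact continuous_spacePoint.comp
      (Continuous.prodMk (h3.mul (this.sub (by fun_prop))) (by fun_prop))

/-- The slope part of the curve that closes the chase. -/
noncomputable def knotSlope (e f : Bool) (y : ℝ) : ℂ :=
  ⟨-(2 * (1 - 4 * y ^ 2)), -(chaseCoeff e f y * (3 * y - 4 * y ^ 3))⟩

/-- The midpoint part of the curve that closes the chase. -/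
noncomputable def knotMidpoint (e f : Bool) (y : ℝ) : ℂ :=
  ⟨-(chaseCoeff e f y * (1 - y ^ 2) * (1 - 4 * y ^ 2)), -(2 * (3 * y - 4 * y ^ 3))⟩

/-- The real part vanishes only at `y = ±1/2`, where `chaseCoeff` is `±1` and `3y - 4y³` is `±1`. -/
theorem knotSlope_ne_zero (e f : Bool) (y : ℝ) : knotSlope e f y ≠ 0 := by
  intro h
  have hr := congrArg Complex.re h
  have hi := congrArg Complex.im h
  simp only [knotSlope, Complex.zero_re, Complex.zero_im] at hr hi
  have h2 : (2 * y - 1) * (2 * y + 1) = 0 := by linear_combination 1 / 2 * hr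
  rcases mul_eq_zero.1 h2 with h2 | h2
  · obtain rfl : y = 1 / 2 := by linarith
    cases e <;> cases f <;> norm_num [chaseCoeff, boolSign] at hi
  · obtain rfl : y = -(1 / 2) := by linarith
    cases e <;> cases f <;> norm_num [chaseCoeff, boolSign] at hi

theorem continuous_knotSlope (e f : Bool) : Continuous (knotSlope e f) := by
  have : knotSlope e f = fun y => ((-(2 * (1 - 4 * y ^ 2)) : ℝ) : ℂ) +
      ((-(chaseCoeff e f y * (3 * y - 4 * y ^ 3)) : ℝ) : ℂ) * Complex.I := by
    funext y
    apply Complex.ext <;> simp [knotSlope, -Complex.ofReal_mul, -Complex.ofReal_neg]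
  rw [this]
  unfold chaseCoeff
  fun_prop

theorem continuous_knotMidpoint (e f : Bool) : Continuous (knotMidpoint e f) := by
  have : knotMidpoint e f = fun y =>
      ((-(chaseCoeff e f y * (1 - y ^ 2) * (1 - 4 * y ^ 2)) : ℝ) : ℂ) +
      ((-(2 * (3 * y - 4 * y ^ 3)) : ℝ) : ℂ) * Complex.I := by
    funext y
    apply Complex.ext <;> simp [knotMidpoint, -Complex.ofReal_mul, -Complex.ofReal_neg]
  rw [this]
  unfold chaseCoeff
  fun_prop

/-- The unit circle in a vertical plane. -/
def verticalCircle : Set E3 := {p | ∃ a : ℝ, p = spacePoint (Real.cos a) (Real.sin a)}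

/-- In terms of the phase `a`, the angle `2πt` is `3a` up to an odd multiple of `π`, for every
strand. After the quarter turn the height is `sin a`; the rest is polynomial in `sin a` and affine
in `cos a`, once `cos² a` is eliminated. -/
theorem torusPoint_chase (e f : Bool) (t : ℝ) (k : Fin 3) :
    torusPoint t (Complex.I * chase e f t k) =
      spacePoint (knotSlope e f (Real.sin (2 * Real.pi * t / 3 + chaseOffset k)) *
        (Real.cos (2 * Real.pi * t / 3 + chaseOffset k) : ℝ) +
        knotMidpoint e f (Real.sin (2 * Real.pi * t / 3 + chaseOffset k)))
        (Real.sin (2 * Real.pi * t / 3 + chaseOffset k)) := by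
  rw [chase]
  generalize ha : 2 * Real.pi * t / 3 + chaseOffset k = a
  have hsq := Real.sin_sq_add_cos_sq a
  have hcs : Real.cos (2 * Real.pi * t) = -Real.cos (3 * a) ∧
      Real.sin (2 * Real.pi * t) = -Real.sin (3 * a) := by
    fin_cases k
    · have : 3 * a = 2 * Real.pi * t - Real.pi := by rw [← ha]; simp [chaseOffset]; ring
      rw [this, Real.cos_sub_pi, Real.sin_sub_pi]
      simp
    · have : 3 * a = 2 * Real.pi * t + Real.pi + 2 * Real.pi := by
        rw [← ha]; simp [chaseOffset]; ring
      rw [this, Real.cos_add_two_pi, Real.sin_add_two_pi, Real.cos_add_pi, Real.sin_add_pi]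
      simp
    · have : 3 * a = 2 * Real.pi * t + Real.pi := by rw [← ha]; simp [chaseOffset]; ring
      rw [this, Real.cos_add_pi, Real.sin_add_pi]
      simp
  have h3 : Real.cos (3 * a) = Real.cos a * (1 - 4 * Real.sin a ^ 2) := by
    rw [Real.cos_three_mul]
    linear_combination 4 * Real.cos a * hsq
  ext i
  fin_cases i
  · simp [torusPoint, spacePoint, chaseCurve, knotSlope, knotMidpoint, hcs, h3,
      -Complex.ofReal_sin, -Complex.ofReal_cos]
    linear_combination -(chaseCoeff e f (Real.sin a)) * (1 - 4 * Real.sin a ^ 2) * hsq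
  · simp [torusPoint, spacePoint, chaseCurve, knotSlope, knotMidpoint, hcs, Real.sin_three_mul,
      -Complex.ofReal_sin, -Complex.ofReal_cos]
    ring
  · simp [torusPoint, spacePoint, chaseCurve]

theorem loopClosure_chase (e f : Bool) :
    loopClosure (fun t => UConf.mk (chaseConf e f (Real.pi / 2) t)) =
      horizontalAffine (knotSlope e f) (knotMidpoint e f) (continuous_knotSlope e f)
        (continuous_knotMidpoint e f) (knotSlope_ne_zero e f) '' verticalCircle := by
  have hI : Complex.exp ((Real.pi / 2 : ℝ) * Complex.I) = Complex.I := by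
    push_cast
    exact Complex.exp_pi_div_two_mul_I
  ext p
  constructor
  · rintro ⟨t, z, ⟨k, rfl⟩, rfl⟩
    simp only [chaseConf, hI]
    rw [torusPoint_chase]
    exact ⟨_, ⟨2 * Real.pi * t / 3 + chaseOffset k, rfl⟩, by simp [horizontalAffine]⟩
  · rintro ⟨_, ⟨a, rfl⟩, rfl⟩
    have hp := Real.pi_pos
    -- A full period from `-π/3` splits into three arcs of length `2π/3`, one for each strand, in
    -- the order 0, 2, 1.
    obtain ⟨n, hn, -⟩ := existsUnique_add_zsmul_mem_Ico (mul_pos two_pos hp) a (-(Real.pi / 3))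
    have key : ∃ (t : I) (k : Fin 3), 2 * Real.pi * t / 3 + chaseOffset k =
        a + n • (2 * Real.pi) := by
      generalize a + n • (2 * Real.pi) = b at hn
      have hk : ∀ k, chaseOffset k ≤ b → b ≤ chaseOffset k + 2 * Real.pi / 3 →
          ∃ (t : I) (k : Fin 3), 2 * Real.pi * t / 3 + chaseOffset k = b := by
        intro k h1 h2
        refine ⟨⟨(b - chaseOffset k) * 3 / (2 * Real.pi), ?_, ?_⟩, k, ?_⟩
        · have := sub_nonneg.2 h1
          positivity
        · rw [div_le_one (by positivity)]
          linarith
        · simp only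
          field_simp
          ring
      rcases le_total b (Real.pi / 3) with h | h
      · exact hk 0 (by simpa [chaseOffset] using hn.1) (by simp [chaseOffset]; linarith)
      rcases le_total b Real.pi with h' | h'
      · exact hk 2 (by simpa [chaseOffset] using h) (by simp [chaseOffset]; linarith)
      · exact hk 1 (by simpa [chaseOffset] using h') (by
          have := hn.2
          simp [chaseOffset]; linarith)
    obtain ⟨t, k, h⟩ := key
    refine ⟨t, Complex.I * chase e f t k, ⟨k, by simp only [chaseConf, hI]⟩, ?_⟩
    rw [torusPoint_chase, h, zsmul_eq_mul, Real.sin_add_int_mul_two_pi,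
      Real.cos_add_int_mul_two_pi]
    simp [horizontalAffine]

/-- Rotation about the first axis combined with a stretching along it. -/
noncomputable def tilt (s : ℝ) (hs : 0 ≤ s) : E3 ≃ₜ E3 where
  toFun p := !₂[(1 + s) * p 0, Real.cos (s * (Real.pi / 2)) * p 1 - Real.sin (s * (Real.pi / 2)) * p 2,
    Real.sin (s * (Real.pi / 2)) * p 1 + Real.cos (s * (Real.pi / 2)) * p 2]
  invFun p := !₂[(1 + s)⁻¹ * p 0,
    Real.cos (s * (Real.pi / 2)) * p 1 + Real.sin (s * (Real.pi / 2)) * p 2,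
    -Real.sin (s * (Real.pi / 2)) * p 1 + Real.cos (s * (Real.pi / 2)) * p 2]
  left_inv p := by
    have h := Real.sin_sq_add_cos_sq (s * (Real.pi / 2))
    have h1 : 1 + s ≠ 0 := by positivity
    ext i
    fin_cases i <;> simp [h1]
    · linear_combination p 1 * h
    · linear_combination p 2 * h
  right_inv p := by
    have h := Real.sin_sq_add_cos_sq (s * (Real.pi / 2))
    have h1 : 1 + s ≠ 0 := by positivity
    ext i
    fin_cases i <;> simp [h1]
    · linear_combination p 1 * h
    · linear_combination p 2 * h
  continuous_toFun := by
    refine (PiLp.continuous_toLp 2 _).comp (continuous_pi fun i => ?_)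
    fin_cases i <;> simp <;> fun_prop
  continuous_invFun := by
    refine (PiLp.continuous_toLp 2 _).comp (continuous_pi fun i => ?_)
    fin_cases i <;> simp <;> fun_prop

/-- The stretching factor 2 is chosen to match `knotSlope e f 0 = -2`; the sign only reparametrises
the circle. -/
theorem tilt_one_image_roundCircle :
    tilt 1 zero_le_one '' roundCircle = horizontalAffine (fun _ => -2) (fun _ => 0)
      continuous_const continuous_const (fun _ => by norm_num) '' verticalCircle := by
  have key : ∀ x y : ℝ, tilt 1 zero_le_one !₂[x, y, 0] =
      horizontalAffine (fun _ => -2) (fun _ => 0)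
      continuous_const continuous_const (fun _ => by norm_num) (spacePoint ((-x : ℝ) : ℂ) y) := by
    intro x y
    ext i
    fin_cases i <;> simp [tilt, horizontalAffine, spacePoint, horizontal]
    norm_num
  ext p
  constructor
  · rintro ⟨p, ⟨h, h2⟩, rfl⟩
    have e : p = !₂[p 0, p 1, 0] := by
      ext i
      fin_cases i <;> simp [h2]
    obtain ⟨a, ha, hb⟩ : ∃ a, Real.cos a = -p 0 ∧ Real.sin a = p 1 := by
      have hn : ‖(⟨-p 0, p 1⟩ : ℂ)‖ = 1 := by
        rw [Complex.norm_def, Complex.normSq_apply, Real.sqrt_eq_one]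
        linear_combination h
      refine ⟨Complex.arg ⟨-p 0, p 1⟩, ?_, ?_⟩
      · have := Complex.norm_mul_cos_arg ⟨-p 0, p 1⟩
        rwa [hn, one_mul] at this
      · have := Complex.norm_mul_sin_arg ⟨-p 0, p 1⟩
        rwa [hn, one_mul] at this
    rw [e, key]
    exact ⟨_, ⟨a, by rw [ha, hb]⟩, rfl⟩
  · rintro ⟨_, ⟨a, rfl⟩, rfl⟩
    refine ⟨!₂[-Real.cos a, Real.sin a, 0], ⟨?_, ?_⟩, ?_⟩
    · simp
    · simp
    · rw [key, neg_neg]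

theorem isUnknot_horizontalAffine (e f : Bool) :
    IsUnknot (horizontalAffine (knotSlope e f) (knotMidpoint e f) (continuous_knotSlope e f)
        (continuous_knotMidpoint e f) (knotSlope_ne_zero e f) '' verticalCircle) := by
  have h1 := AmbientIsotopic.of_family (fun s : I => tilt s s.2.1) (by
    change Continuous fun p : I × E3 => (!₂[(1 + (p.1 : ℝ)) * p.2 0,
      Real.cos (p.1 * (Real.pi / 2)) * p.2 1 - Real.sin (p.1 * (Real.pi / 2)) * p.2 2,
      Real.sin (p.1 * (Real.pi / 2)) * p.2 1 + Real.cos (p.1 * (Real.pi / 2)) * p.2 2] : E3)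
    refine (PiLp.continuous_toLp 2 _).comp (continuous_pi fun i => ?_)
    fin_cases i <;> simp <;> fun_prop) roundCircle
  have e0 : tilt ((0 : I) : ℝ) (0 : I).2.1 '' roundCircle = roundCircle := by
    have : ⇑(tilt ((0 : I) : ℝ) (0 : I).2.1) = id := by
      funext p
      ext i
      fin_cases i <;> simp [tilt]
    rw [this, Set.image_id]
  have e1 : tilt ((1 : I) : ℝ) (1 : I).2.1 '' roundCircle = _ := tilt_one_image_roundCircle
  rw [e0, e1] at h1
  have hs := continuous_knotSlope e f
  have hm := continuous_knotMidpoint e f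
  -- Rescaling the argument keeps the slope nonzero throughout and makes it constant at `s = 0`,
  -- where the midpoint term vanishes too.
  have h2 := AmbientIsotopic.of_family (fun s : I => horizontalAffine (fun y => knotSlope e f (s * y))
    (fun y => s * knotMidpoint e f y) (by fun_prop) (by fun_prop)
    (fun y => knotSlope_ne_zero e f _)) (by
      have := continuous_horizontal
      change Continuous fun p : I × E3 => spacePoint (knotSlope e f (p.1 * p.2 2) *
        horizontal p.2 + p.1 * knotMidpoint e f (p.2 2)) (p.2 2)
      exact continuous_spacePoint.comp (Continuous.prodMk (by fun_prop) (by fun_prop)))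
    verticalCircle
  have e2 : knotSlope e f 0 = -2 := by
    apply Complex.ext <;> simp [knotSlope]
  simp only [Set.Icc.coe_zero, Set.Icc.coe_one, zero_mul, one_mul, e2, Complex.ofReal_zero,
    Complex.ofReal_one] at h2
  exact (h1.trans h2).symm

/-- A braid conjugate to a product of one letter of each kind closes to the unknot. -/
theorem isUnknot_closedBraid {w : Word (Fin 2)} {e f : Bool}
    (h : IsConj (evalWord artin w) (evalWord artin [(0, e), (1, f)])) :
    IsUnknot (closedBraid w) := by
  have h1 := ((ambientIsotopic_closedBraid h).trans (ambientIsotopic_chase_zero e f)).trans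
    (ambientIsotopic_chase_rotate e f)
  rw [loopClosure_chase] at h1
  exact h1.trans (isUnknot_horizontalAffine e f)

/-! ### Components of the closure -/

/-- A strand of the closed braid of a word, as a curve in space. -/
noncomputable def closedStrand (w : Word (Fin 2)) (k : Fin 3) (t : I) : E3 :=
  torusPoint t (strand w ((w.length + 1) * t) k)

theorem continuous_closedStrand (w : Word (Fin 2)) (k : Fin 3) : Continuous (closedStrand w k) := by
  have := continuous_strand w k
  exact continuous_torusPoint.comp
    (f := fun t : I => ((t : ℝ), strand w ((w.length + 1) * t) k)) (by fun_prop)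

theorem closedBraid_eq_iUnion (w : Word (Fin 2)) :
    closedBraid w = ⋃ k, Set.range (closedStrand w k) := by
  rw [closedBraid_eq_loopClosure]
  ext p
  simp only [Set.mem_iUnion]
  constructor
  · rintro ⟨t, _, ⟨k, rfl⟩, rfl⟩
    exact ⟨k, t, rfl⟩
  · rintro ⟨k, t, rfl⟩
    exact ⟨t, _, ⟨k, rfl⟩, rfl⟩

/-- A strand fixed by the permutation closes up on itself: within a section strands are distinct,
and across the seam strand `k` meets only strand `k`. -/
theorem closedStrand_eq {w : Word (Fin 2)} {i k : Fin 3}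
    (hk : permHom (evalWord artin w) k = k) {t t' : I}
    (h : closedStrand w i t = closedStrand w k t') : i = k := by
  have hre : ∀ s j, -2 < (strand w s j).re := fun s j => by
    linarith [(abs_le.1 (abs_re_strand_le w s j)).1]
  have hk' : (permHom (evalWord artin w))⁻¹ k = k := Equiv.Perm.inv_eq_iff_eq.2 hk.symm
  have hend : ∀ j, strand w ((w.length + 1) * 1) j =
      basePts ((permHom (evalWord artin w))⁻¹ j) := fun j =>
    strand_of_length_le w (by linarith) j
  obtain ⟨e, h1 | h1 | ⟨h1, h2⟩ | ⟨h1, h2⟩⟩ := torusPoint_inj t.2 t'.2 (hre _ _).le (hre _ _).le h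
  · exact absurd h1 (hre _ _).ne'
  · rw [h1] at e
    exact injective_strand _ _ e
  · rw [h1, h2, mul_zero, strand_of_nonpos _ le_rfl, hend, hk'] at e
    exact injective_basePts e
  · rw [h1, h2, mul_zero, strand_of_nonpos _ le_rfl, hend] at e
    exact (permHom (evalWord artin w))⁻¹.injective ((injective_basePts e).trans hk'.symm)

/-- The permutation of a braid that closes to a knot has no fixed points. -/
theorem fixedPointFree_of_isKnot {w : Word (Fin 2)} (h : IsKnot (closedBraid w)) :
    FixedPointFree (permHom (evalWord artin w)) := by
  intro k hk
  have hpre : IsPreconnected (closedBraid w) := by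
    obtain ⟨f, hf, -, -, -, hr⟩ := h
    rw [← hr]
    exact isPreconnected_range hf.continuous
  have hcl : ∀ i, IsClosed (Set.range (closedStrand w i)) := fun i =>
    (isCompact_range (continuous_closedStrand w i)).isClosed
  have hmem : ∀ i, closedStrand w i 0 ∈ closedBraid w := fun i => by
    rw [closedBraid_eq_iUnion]
    exact Set.mem_iUnion.2 ⟨i, 0, rfl⟩
  have hcov : closedBraid w ⊆ Set.range (closedStrand w k) ∪
      ⋃ i : {i // i ≠ k}, Set.range (closedStrand w i) := by
    rw [closedBraid_eq_iUnion]
    refine Set.iUnion_subset fun i => ?_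
    by_cases hi : i = k
    · subst hi
      exact Set.subset_union_left
    · exact (Set.subset_iUnion (fun i : {i // i ≠ k} => Set.range (closedStrand w i))
        ⟨i, hi⟩).trans Set.subset_union_right
  have hdisj : closedBraid w ∩ (Set.range (closedStrand w k) ∩
      ⋃ i : {i // i ≠ k}, Set.range (closedStrand w i)) = ∅ := by
    refine Set.eq_empty_of_forall_notMem ?_
    rintro _ ⟨-, ⟨t, rfl⟩, hu⟩
    obtain ⟨⟨i, hi⟩, t', ht⟩ := Set.mem_iUnion.1 hu
    exact hi (closedStrand_eq hk ht)
  -- The fixed strand and the union of the others are disjoint nonempty closed sets covering a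
  -- connected knot.
  rcases isPreconnected_iff_subset_of_disjoint_closed.1 hpre _ _ (hcl k)
    (isClosed_iUnion_of_finite fun i : {i // i ≠ k} => hcl i) hcov hdisj with hs | hs
  · obtain ⟨i, hi⟩ := exists_ne k
    obtain ⟨t, ht⟩ := hs (hmem i)
    exact hi (closedStrand_eq hk ht.symm)
  · obtain ⟨⟨i, hi⟩, t, ht⟩ := Set.mem_iUnion.1 (hs (hmem k))
    exact hi (closedStrand_eq hk ht)

end ThreeBraid

theorem mainTheorem4 (α : ThreeBraid.B3) (K : Set ThreeBraid.E3)
    (hK : ThreeBraid.IsClosureOf K α) (hknot : ThreeBraid.IsKnot K)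
    (hnontrivial : ¬ ThreeBraid.IsUnknot K) :
    ∃ (W : ThreeBraid.Word (Fin 3)) (ε : Bool),
      IsConj α (ThreeBraid.evalWord ThreeBraid.band (W ++ [(0, ε), (0, ε)])) ∧
        ThreeBraid.IsShortestInConjClass (W ++ [(0, ε), (0, ε)]) α := by
  obtain ⟨w, rfl, rfl⟩ := hK
  rcases ThreeBraid.hasSquare_or_isConj w (ThreeBraid.fixedPointFree_of_isKnot hknot) with h |
    ⟨e, f, h⟩
  · obtain ⟨W, ε, hW⟩ := h.exists_index_zero
    exact ⟨W, ε, hW.1, hW⟩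
  · exact absurd (ThreeBraid.isUnknot_closedBraid h) hnontrivial
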